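/- Let $G$ be a finite group. Let $\mathcal{P}_G$ be the category whose objects are the finite $G$-sets, whose morphisms $X \to Y$ are the isomorphism classes of diagrams (bispans) $X \xleftarrow{r} A \xrightarrow{n} B \xrightarrow{t} Y$ of finite $G$-sets, and in which the composite of $X \leftarrow A \to B \to Y$ with $Y \leftarrow C \xrightarrow{q} D \to Z$ is $X \leftarrow A'' \to B'' \to Z$, where $B'' \to D$ is the dependent product along $q$ of $B \times_Y C \to C$ (so a point of $B''$ is a point $d \in D$ with a section of $B \times_Y C \to C$ over $q^{-1}(d)$) and $A'' = A \times_B (C \times_D B'')$, formed using the evaluation map $C \times_D B'' \to B$. Finite products in $\mathcal{P}_G$ are disjoint unions. For an equivariant map $f : X \to Y$ put $T_f = [X = X = X \xrightarrow{f} Y]$, $N_f = [X = X \xrightarrow{f} Y = Y]$ and $R_f = [Y \xleftarrow{f} X = X = X]$. A $G$-Tambara functor is a functor $T : \mathcal{P}_G \to \mathrm{Set}$ that preserves finite products and for which each $T(X)$, with the commutative semiring structure whose addition and multiplication are induced by $T_\nabla$ and $N_\nabla$ for the fold map $\nabla : X \amalg X \to X$ and whose $0$ and $1$ are induced by $T_!$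 and $N_!$ for $! : \varnothing \to X$, is a commutative ring. Write $\mathrm{tr}_f = T(T_f)$, $\mathrm{nm}_f = T(N_f)$, $\mathrm{res}_f = T(R_f)$. An ideal $I$ of $T$ is a family of ideals $I(G/H) \subseteq T(G/H)$, one for each subgroup $H \le G$, closed under $\mathrm{res}$, $\mathrm{tr}$ and $\mathrm{nm}$ along the projections $G/H \to G/K$ ($H \le K$) and under the conjugations induced by the isomorphisms $G/H \to G/gHg^{-1}$, $xH \mapsto xg^{-1}(gHg^{-1})$. The product $IJ$ is the smallest ideal $K$ with $I(G/H)\,J(G/H) \subseteq K(G/H)$ for all $H \le G$. An ideal $\mathfrak{p} \ne T$ is prime if $IJ \subseteq \mathfrak{p}$ implies $I \subseteq \mathfrak{p}$ or $J \subseteq \mathfrak{p}$ for all ideals $I, J$ of $T$. The Nakaoka spectrum $\mathrm{Spec}(T)$ is the set of prime ideals of $T$, with the topology whose closed sets are the sets $V(I) = \{\mathfrak{p} : I \subseteq \mathfrak{p}\}$ for $I$ an ideal of $T$. **Proposition.** For every finite group $G$, every $G$-Tambara functor $T$, every subgroup $H \le G$ and every element $f \in T(G/H)$, the basic open set $$D(f)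 = \{\mathfrak{p} \in \mathrm{Spec}(T) : f \notin \mathfrak{p}(G/H)\}$$ of $\mathrm{Spec}(T)$ is quasi-compact, i.e. every cover of $D(f)$ by open subsets of $\mathrm{Spec}(T)$ has a finite subcover. -/

import Mathlib

open CategoryTheory

universe u v

namespace Tambara

/-! ## Finite `G`-sets -/

/-- A finite `G`-set. Its equivariant maps are Mathlib's `X →[G] Y`. -/
structure FinGSet (G : Type u) [Group G] : Type (u + 1) where
  carrier : Type u
  [mulAction : MulAction G carrier]
  [finite : Finite carrier]

instance FinGSet.instCoeSort (G : Type u) [Group G] : CoeSort (FinGSet G) (Type u) :=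
  ⟨FinGSet.carrier⟩

attribute [instance] FinGSet.mulAction FinGSet.finite

section GSets

variable {G : Type u} [Group G]

/-- The empty `G`-set. -/
def FinGSet.empty (G : Type u) [Group G] : FinGSet G :=
  letI : MulAction G PEmpty.{u + 1} :=
    { smul := fun _ x => x, one_smul := fun _ => rfl, mul_smul := fun _ _ _ => rfl }
  ⟨PEmpty.{u + 1}⟩

instance FinGSet.isEmpty_empty : IsEmpty (FinGSet.empty G) :=
  inferInstanceAs (IsEmpty PEmpty.{u + 1})

/-- The disjoint union of two finite `G`-sets. -/
def FinGSet.sum (X Y : FinGSet G) : FinGSet G := ⟨X ⊕ Y⟩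

/-- The orbit `G/H`, with `G` acting by left translation. -/
def FinGSet.orbit [Finite G] (H : Subgroup G) : FinGSet G := ⟨G ⧸ H⟩

/-- The left inclusion `X → X ⨿ Y`. -/
def inl (X Y : FinGSet G) : X →[G] X.sum Y where
  toFun := Sum.inl
  map_smul' _ _ := rfl

/-- The right inclusion `Y → X ⨿ Y`. -/
def inr (X Y : FinGSet G) : Y →[G] X.sum Y where
  toFun := Sum.inr
  map_smul' _ _ := rfl

/-- The map `X ⨿ Y → Z` with components `f` and `g`. -/
def copair {X Y Z : FinGSet G} (f : X →[G] Z) (g : Y →[G] Z) : X.sum Y →[G] Z where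
  toFun := Sum.elim f g
  map_smul' m x := match x with
    | Sum.inl x => map_smul f m x
    | Sum.inr y => map_smul g m y

/-- The map `f ⨿ g : X ⨿ Y → X' ⨿ Y'`. -/
def sumMap {X Y X' Y' : FinGSet G} (f : X →[G] X') (g : Y →[G] Y') :
    X.sum Y →[G] X'.sum Y' where
  toFun := Sum.map f g
  map_smul' m x := match x with
    | Sum.inl x => congrArg Sum.inl (map_smul f m x)
    | Sum.inr y => congrArg Sum.inr (map_smul g m y)

/-- The fold map `∇ : X ⨿ X → X`. -/
def fold (X : FinGSet G) : X.sum X →[G] X := copair (MulActionHom.id G) (MulActionHom.id G)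

/-- The unique map `∅ → X`. -/
def bang (X : FinGSet G) : FinGSet.empty G →[G] X where
  toFun x := isEmptyElim x
  map_smul' _ x := isEmptyElim x

end GSets

/-! ## Bispans -/

/-- A bispan `X ←r A →n B →t Y` of finite `G`-sets. -/
structure Bispan {G : Type u} [Group G] (X Y : FinGSet G) : Type (u + 1) where
  A : FinGSet G
  B : FinGSet G
  r : A →[G] X
  n : A →[G] B
  t : B →[G] Y

section Bispans

variable {G : Type u} [Group G]

/-- An isomorphism of bispans: equivariant bijections `A ≃ A'` and `B ≃ B'` compatible with all
the structure maps. -/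
structure BispanIso {X Y : FinGSet G} (β γ : Bispan X Y) : Type u where
  a : β.A ≃ γ.A
  b : β.B ≃ γ.B
  a_smul : ∀ (g : G) (x : β.A), a (g • x) = g • a x
  b_smul : ∀ (g : G) (x : β.B), b (g • x) = g • b x
  r_comm : ∀ x : β.A, γ.r (a x) = β.r x
  n_comm : ∀ x : β.A, γ.n (a x) = b (β.n x)
  t_comm : ∀ x : β.B, γ.t (b x) = β.t x

/-- The identity isomorphism. -/
def BispanIso.refl {X Y : FinGSet G} (β : Bispan X Y) : BispanIso β β where
  a := Equiv.refl _
  b := Equiv.refl _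
  a_smul _ _ := rfl
  b_smul _ _ := rfl
  r_comm _ := rfl
  n_comm _ := rfl
  t_comm _ := rfl

/-- The inverse isomorphism. -/
def BispanIso.symm {X Y : FinGSet G} {β γ : Bispan X Y} (e : BispanIso β γ) : BispanIso γ β where
  a := e.a.symm
  b := e.b.symm
  a_smul g x := by rw [Equiv.symm_apply_eq, e.a_smul, Equiv.apply_symm_apply]
  b_smul g x := by rw [Equiv.symm_apply_eq, e.b_smul, Equiv.apply_symm_apply]
  r_comm x := by rw [← e.r_comm, Equiv.apply_symm_apply]
  n_comm x := by rw [Equiv.eq_symm_apply, ← e.n_comm, Equiv.apply_symm_apply]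
  t_comm x := by rw [← e.t_comm, Equiv.apply_symm_apply]

/-- Composition of isomorphisms. -/
def BispanIso.trans {X Y : FinGSet G} {β γ δ : Bispan X Y} (e : BispanIso β γ)
    (f : BispanIso γ δ) : BispanIso β δ where
  a := e.a.trans f.a
  b := e.b.trans f.b
  a_smul g x := by simp [e.a_smul, f.a_smul]
  b_smul g x := by simp [e.b_smul, f.b_smul]
  r_comm x := by simp [e.r_comm, f.r_comm]
  n_comm x := by simp [e.n_comm, f.n_comm]
  t_comm x := by simp [e.t_comm, f.t_comm]

instance Bispan.instSetoid (X Y : FinGSet G) : Setoid (Bispan X Y) where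
  r β γ := Nonempty (BispanIso β γ)
  iseqv :=
    { refl := fun β => ⟨BispanIso.refl β⟩
      symm := fun ⟨e⟩ => ⟨e.symm⟩
      trans := fun ⟨e⟩ ⟨f⟩ => ⟨e.trans f⟩ }

/-- The identity bispan. -/
def Bispan.id (X : FinGSet G) : Bispan X X :=
  ⟨X, X, MulActionHom.id G, MulActionHom.id G, MulActionHom.id G⟩

variable {X Y Z W : FinGSet G}

/-- For `X ← A → B → Y` and `Y ← C → D → Z`, the dependent product of `B ×_Y C → C` along
`C → D`: its points are a point `d` of `D` together with a section over the fibre of `C → D` at `d`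
of the projection `B ×_Y C → C`, i.e. a function `s` from this fibre to `B` such that
`s c` and `c` have the same image in `Y`. -/
structure CompB (β : Bispan X Y) (γ : Bispan Y Z) : Type u where
  d : γ.B
  s : ∀ c : γ.A, γ.n c = d → β.B
  hs : ∀ (c : γ.A) (h : γ.n c = d), β.t (s c h) = γ.r c

/-- The points over which the norm of the composite is taken: a point `(d, s)` of the dependent
product, a point `c` of the fibre of `C → D` at `d`, and a point `a` of the fibre of `A → B` at
`s c`. -/
structure CompA (β : Bispan X Y) (γ : Bispan Y Z) : Type u where
  p : CompB β γ
  c : γ.A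
  hc : γ.n c = p.d
  a : β.A
  ha : β.n a = p.s c hc

theorem CompB.ext' {β : Bispan X Y} {γ : Bispan Y Z} {p q : CompB β γ} (hd : p.d = q.d)
    (h : ∀ c hc hc', p.s c hc = q.s c hc') : p = q := by
  obtain ⟨d, s, hs⟩ := p
  obtain ⟨d', s', hs'⟩ := q
  obtain rfl : d = d' := hd
  obtain rfl : s = s' := by
    funext c hc
    exact h c hc hc
  rfl

theorem CompB.s_congr {β : Bispan X Y} {γ : Bispan Y Z} {p q : CompB β γ} (h : p = q)
    {c c' : γ.A} (hcc : c = c') (hc : γ.n c = p.d) (hc' : γ.n c' = q.d) :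
    p.s c hc = q.s c' hc' := by
  subst h hcc
  rfl

theorem CompA.ext' {β : Bispan X Y} {γ : Bispan Y Z} {p q : CompA β γ} (hp : p.p = q.p)
    (hc : p.c = q.c) (ha : p.a = q.a) : p = q := by
  obtain ⟨p, c, hc, a, ha⟩ := p
  obtain ⟨p', c', hc', a', ha'⟩ := q
  subst hp hc ha
  rfl

instance CompB.instFinite (β : Bispan X Y) (γ : Bispan Y Z) : Finite (CompB β γ) :=
  Finite.of_injective
    (fun p : CompB β γ =>
      (⟨p.d, fun c => p.s c.1 c.2⟩ : Σ d : γ.B, ({c : γ.A // γ.n c = d} → β.B))) (by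
    rintro ⟨d, s, hs⟩ ⟨d', s', hs'⟩ h
    obtain ⟨rfl, h⟩ := Sigma.mk.inj_iff.1 h
    refine CompB.ext' rfl fun c hc hc' => ?_
    exact congrFun (eq_of_heq h) ⟨c, hc⟩)

instance CompA.instFinite (β : Bispan X Y) (γ : Bispan Y Z) : Finite (CompA β γ) :=
  Finite.of_injective (fun p : CompA β γ => (p.p, p.c, p.a)) (by
    intro p q h
    simp only [Prod.mk.injEq] at h
    exact CompA.ext' h.1 h.2.1 h.2.2)

/-- `G` acts on sections by conjugation: `(g • s) c = g • s (g⁻¹ • c)`. -/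
instance CompB.instMulAction (β : Bispan X Y) (γ : Bispan Y Z) : MulAction G (CompB β γ) where
  smul g p :=
    { d := g • p.d
      s := fun c hc => g • p.s (g⁻¹ • c) (by rw [map_smul, hc, inv_smul_smul])
      hs := fun c hc => by rw [map_smul, p.hs, map_smul, smul_inv_smul] }
  one_smul p := by
    refine CompB.ext' (one_smul G p.d) fun c hc hc' => ?_
    change (1 : G) • p.s ((1 : G)⁻¹ • c) _ = p.s c hc'
    rw [one_smul]
    exact CompB.s_congr rfl (by simp) _ _
  mul_smul g h p := by
    refine CompB.ext' (mul_smul g h p.d) fun c hc hc' => ?_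
    change (g * h) • p.s ((g * h)⁻¹ • c) _ = g • h • p.s (h⁻¹ • g⁻¹ • c) _
    rw [mul_smul]
    exact congrArg _ (congrArg _ (CompB.s_congr rfl (by simp [mul_smul]) _ _))

theorem CompB.smul_d {β : Bispan X Y} {γ : Bispan Y Z} (g : G) (p : CompB β γ) :
    (g • p).d = g • p.d := rfl

theorem CompB.smul_s {β : Bispan X Y} {γ : Bispan Y Z} (g : G) (p : CompB β γ) (c : γ.A)
    (hc : γ.n c = (g • p).d) (hc' : γ.n (g⁻¹ • c) = p.d) :
    (g • p).s c hc = g • p.s (g⁻¹ • c) hc' := rfl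

theorem CompB.smul_s_smul {β : Bispan X Y} {γ : Bispan Y Z} (g : G) (p : CompB β γ) (c : γ.A)
    (hc : γ.n (g • c) = (g • p).d) (hc' : γ.n c = p.d) :
    (g • p).s (g • c) hc = g • p.s c hc' := by
  rw [CompB.smul_s g p _ _ (by simpa using hc')]
  exact congrArg _ (CompB.s_congr rfl (by simp) _ _)

instance CompA.instMulAction (β : Bispan X Y) (γ : Bispan Y Z) : MulAction G (CompA β γ) where
  smul g p :=
    { p := g • p.p
      c := g • p.c
      hc := by rw [map_smul, p.hc]; rfl
      a := g • p.a
      ha := by rw [CompB.smul_s_smul g p.p p.c _ p.hc, map_smul, p.ha] }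
  one_smul p := CompA.ext' (one_smul G _) (one_smul G _) (one_smul G _)
  mul_smul g h p := CompA.ext' (mul_smul g h _) (mul_smul g h _) (mul_smul g h _)

/-- The composite of the bispans `β : X ← A → B → Y` and `γ : Y ← C → D → Z` (first `β`, then
`γ`). -/
def Bispan.comp (β : Bispan X Y) (γ : Bispan Y Z) : Bispan X Z where
  A := ⟨CompA β γ⟩
  B := ⟨CompB β γ⟩
  r := { toFun := fun p => β.r p.a, map_smul' := fun g p => map_smul β.r g p.a }
  n := { toFun := fun p => p.p, map_smul' := fun _ _ => rfl }
  t := { toFun := fun p => γ.t p.d, map_smul' := fun g p => map_smul γ.t g p.d }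

/-- Isomorphisms of bispans act on the dependent product. -/
def CompB.map {β β' : Bispan X Y} {γ γ' : Bispan Y Z} (e : BispanIso β β') (f : BispanIso γ γ')
    (p : CompB β γ) : CompB β' γ' where
  d := f.b p.d
  s c hc := e.b (p.s (f.a.symm c) (by
    rw [← f.b.apply_eq_iff_eq, ← f.n_comm, Equiv.apply_symm_apply, hc]))
  hs c hc := by rw [e.t_comm, p.hs, ← f.r_comm, Equiv.apply_symm_apply]

theorem CompB.map_s {β β' : Bispan X Y} {γ γ' : Bispan Y Z} (e : BispanIso β β')
    (f : BispanIso γ γ') (p : CompB β γ) (c : γ.A) (hc : γ.n c = p.d)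
    (hc' : γ'.n (f.a c) = (p.map e f).d) : (p.map e f).s (f.a c) hc' = e.b (p.s c hc) :=
  congrArg _ (CompB.s_congr rfl (by simp) _ _)

/-- Isomorphisms of bispans act on the domain of the norm. -/
def CompA.map {β β' : Bispan X Y} {γ γ' : Bispan Y Z} (e : BispanIso β β') (f : BispanIso γ γ')
    (p : CompA β γ) : CompA β' γ' where
  p := p.p.map e f
  c := f.a p.c
  hc := by rw [f.n_comm, p.hc]; rfl
  a := e.a p.a
  ha := by rw [CompB.map_s e f p.p p.c p.hc, e.n_comm, p.ha]

theorem CompB.map_symm_map {β β' : Bispan X Y} {γ γ' : Bispan Y Z} (e : BispanIso β β')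
    (f : BispanIso γ γ') (p : CompB β γ) : (p.map e f).map e.symm f.symm = p := by
  refine CompB.ext' (f.b.symm_apply_apply _) fun c hc hc' => ?_
  change e.b.symm (e.b (p.s (f.a.symm (f.a c)) _)) = _
  rw [Equiv.symm_apply_apply]
  exact CompB.s_congr rfl (by simp) _ _

theorem CompA.map_symm_map {β β' : Bispan X Y} {γ γ' : Bispan Y Z} (e : BispanIso β β')
    (f : BispanIso γ γ') (p : CompA β γ) : (p.map e f).map e.symm f.symm = p :=
  CompA.ext' (CompB.map_symm_map e f p.p) (f.a.symm_apply_apply _) (e.a.symm_apply_apply _)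

theorem CompB.map_smul {β β' : Bispan X Y} {γ γ' : Bispan Y Z} (e : BispanIso β β')
    (f : BispanIso γ γ') (g : G) (p : CompB β γ) : (g • p).map e f = g • p.map e f := by
  refine CompB.ext' (f.b_smul g p.d) fun c hc hc' => ?_
  change e.b (g • p.s (g⁻¹ • f.a.symm c) _) = g • e.b (p.s (f.a.symm (g⁻¹ • c)) _)
  rw [e.b_smul]
  exact congrArg _ (congrArg _ (CompB.s_congr rfl (f.symm.a_smul _ _).symm _ _))

/-- Composition of bispans respects isomorphism. -/
def Bispan.compIso {β β' : Bispan X Y} {γ γ' : Bispan Y Z} (e : BispanIso β β')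
    (f : BispanIso γ γ') : BispanIso (β.comp γ) (β'.comp γ') where
  a := ⟨CompA.map e f, CompA.map e.symm f.symm, CompA.map_symm_map e f,
    CompA.map_symm_map e.symm f.symm⟩
  b := ⟨CompB.map e f, CompB.map e.symm f.symm, CompB.map_symm_map e f,
    CompB.map_symm_map e.symm f.symm⟩
  a_smul g x := CompA.ext' (CompB.map_smul e f g x.p) (f.a_smul g x.c) (e.a_smul g x.a)
  b_smul g x := CompB.map_smul e f g x
  r_comm x := e.r_comm x.a
  n_comm _ := rfl
  t_comm x := f.t_comm x.d

theorem Bispan.comp_equiv {β β' : Bispan X Y} {γ γ' : Bispan Y Z} (e : β ≈ β') (f : γ ≈ γ') :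
    β.comp γ ≈ β'.comp γ' :=
  ⟨Bispan.compIso e.some f.some⟩

/-- Composing `X ← Y = Y = Y` with a bispan amounts to composing its first leg with `Y → X`. -/
def Bispan.compRIso (f : Y →[G] X) (γ : Bispan Y Z) :
    BispanIso (Bispan.comp ⟨Y, Y, f, MulActionHom.id G, MulActionHom.id G⟩ γ)
      ⟨γ.A, γ.B, f.comp γ.r, γ.n, γ.t⟩ where
  a :=
    { toFun := fun p => p.c
      invFun := fun c => ⟨⟨γ.n c, fun c _ => γ.r c, fun _ _ => rfl⟩, c, rfl, γ.r c, rfl⟩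
      left_inv := fun p => by
        refine CompA.ext' (CompB.ext' p.hc fun c hc hc' => (p.p.hs c hc').symm) rfl ?_
        exact (p.p.hs p.c p.hc).symm.trans p.ha.symm
      right_inv := fun _ => rfl }
  b :=
    { toFun := fun p => p.d
      invFun := fun d => ⟨d, fun c _ => γ.r c, fun _ _ => rfl⟩
      left_inv := fun p => CompB.ext' rfl fun c hc hc' => (p.hs c hc').symm
      right_inv := fun _ => rfl }
  a_smul _ _ := rfl
  b_smul _ _ := rfl
  r_comm p := congrArg f ((p.p.hs p.c p.hc).symm.trans p.ha.symm)
  n_comm p := p.hc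
  t_comm _ := rfl

/-- Composing a bispan with `Y = Y = Y → Z` amounts to composing its last leg with `Y → Z`. -/
def Bispan.compTIso (β : Bispan X Y) (f : Y →[G] Z) :
    BispanIso (β.comp ⟨Y, Y, MulActionHom.id G, MulActionHom.id G, f⟩)
      ⟨β.A, β.B, β.r, β.n, f.comp β.t⟩ where
  a :=
    { toFun := fun p => p.a
      invFun := fun a => ⟨⟨β.t (β.n a), fun _ _ => β.n a, fun _ h => h.symm⟩, β.t (β.n a), rfl, a,
        rfl⟩
      left_inv := fun p => by
        obtain ⟨⟨d, s, hs⟩, c, hc, a, ha⟩ := p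
        obtain rfl : c = d := hc
        have h : β.t (β.n a) = c := (congrArg β.t ha).trans (hs c rfl)
        refine CompA.ext' (CompB.ext' h fun c' hc hc' => ?_) h rfl
        obtain rfl : c' = c := hc'
        exact ha
      right_inv := fun _ => rfl }
  b :=
    { toFun := fun p => p.s p.d rfl
      invFun := fun b => ⟨β.t b, fun _ _ => b, fun _ h => h.symm⟩
      left_inv := fun p => by
        refine CompB.ext' (p.hs p.d rfl) fun c hc hc' => ?_
        exact CompB.s_congr (p := p) (c := p.d) (c' := c) rfl hc'.symm _ _
      right_inv := fun _ => rfl }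
  a_smul _ _ := rfl
  b_smul g p := CompB.smul_s_smul g p p.d rfl rfl
  r_comm _ := rfl
  n_comm p := p.ha.trans (CompB.s_congr rfl p.hc _ _)
  t_comm p := congrArg f (p.hs p.d rfl)

/-- Left unit law. -/
def Bispan.idComp (γ : Bispan X Y) : BispanIso ((Bispan.id X).comp γ) γ :=
  Bispan.compRIso (MulActionHom.id G) γ

/-- Right unit law. -/
def Bispan.compId (β : Bispan X Y) : BispanIso (β.comp (Bispan.id Y)) β :=
  Bispan.compTIso β (MulActionHom.id G)

/-- Associativity. Both sides consist of a point `f` of the target of the norm of `δ` together with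
sections over the fibre at `f`, in curried and uncurried form respectively. -/
def Bispan.compAssoc (β : Bispan X Y) (γ : Bispan Y Z) (δ : Bispan Z W) :
    BispanIso ((β.comp γ).comp δ) (β.comp (γ.comp δ)) :=
  let toB : CompB (β.comp γ) δ → CompB β (γ.comp δ) := fun p =>
    { d := ⟨p.d, fun e he => (p.s e he).d, p.hs⟩
      s := fun x hx => (p.s x.c (x.hc.trans (congrArg CompB.d hx))).s x.a
        (x.ha.trans (CompB.s_congr hx rfl _ _))
      hs := fun x hx => CompB.hs _ _ _ }
  let invB : CompB β (γ.comp δ) → CompB (β.comp γ) δ := fun q =>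
    { d := q.d.d
      s := fun e he => ⟨q.d.s e he, fun c hc => q.s ⟨q.d, e, he, c, hc⟩ rfl,
        fun c hc => q.hs ⟨q.d, e, he, c, hc⟩ rfl⟩
      hs := q.d.hs }
  have l : Function.LeftInverse invB toB := fun p => by
    refine CompB.ext' rfl fun e he he' => ?_
    exact CompB.ext' rfl fun c hc hc' => rfl
  have r : Function.RightInverse invB toB := fun q => by
    refine CompB.ext' rfl fun x hx hx' => ?_
    obtain ⟨y, e, he, c, hc⟩ := x
    obtain rfl : y = q.d := hx'
    rfl
  { b := ⟨toB, invB, l, r⟩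
    a :=
      { toFun := fun x =>
          { p := toB x.p
            c := ⟨(toB x.p).d, x.c, x.hc, x.a.c, x.a.hc.trans (congrArg CompB.d x.ha)⟩
            hc := rfl
            a := x.a.a
            ha := x.a.ha.trans (CompB.s_congr x.ha rfl _ _) }
        invFun := fun y =>
          { p := invB y.p
            c := y.c.c
            hc := y.c.hc.trans (congrArg CompB.d y.hc)
            a :=
              { p := (invB y.p).s y.c.c (y.c.hc.trans (congrArg CompB.d y.hc))
                c := y.c.a
                hc := y.c.ha.trans (CompB.s_congr y.hc rfl _ _)
                a := y.a
                ha := y.ha.trans (CompB.s_congr (p := y.p) (c := y.c)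
                (c' := ⟨y.p.d, y.c.c, y.c.hc.trans (congrArg CompB.d y.hc), y.c.a,
                  y.c.ha.trans (CompB.s_congr y.hc rfl _ _)⟩)
                rfl (CompA.ext' (p := y.c) y.hc rfl rfl) _ _) }
            ha := rfl }
        left_inv := fun x => CompA.ext' (l x.p) rfl
          (CompA.ext' ((CompB.s_congr (l x.p) rfl _ x.hc).trans x.ha.symm) rfl rfl)
        right_inv := fun y => CompA.ext' (r y.p)
          (CompA.ext' ((congrArg CompB.d (r y.p)).trans y.hc.symm) rfl rfl) rfl }
    a_smul := fun g x => by
      have h : toB (g • x.p) = g • toB x.p := by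
        refine CompB.ext' (CompB.ext' rfl fun e he he' => rfl) fun y hy hy' => ?_
        rfl
      exact CompA.ext' h (CompA.ext' (congrArg CompB.d h) rfl rfl) rfl
    b_smul := fun g p => by
      refine CompB.ext' (CompB.ext' rfl fun e he he' => rfl) fun y hy hy' => ?_
      rfl
    r_comm := fun _ => rfl
    n_comm := fun _ => rfl
    t_comm := fun _ => rfl }

end Bispans
/-! ## The polynomial category -/

/-- The category of polynomials (bispans): its objects are the finite `G`-sets. -/
abbrev PolyCat (G : Type u) [Group G] : Type (u + 1) := FinGSet G

section Poly

variable {G : Type u} [Group G]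

/-- A morphism `X ⟶ Y` is an isomorphism class of bispans `X ← A → B → Y`. -/
instance PolyCat.instCategory : Category.{u + 1} (PolyCat G) where
  Hom X Y := Quotient (Bispan.instSetoid (G := G) X Y)
  id X := Quotient.mk _ (Bispan.id (G := G) X)
  comp f g := Quotient.map₂ Bispan.comp (fun _ _ e _ _ f => Bispan.comp_equiv e f) f g
  id_comp f := Quotient.inductionOn f fun γ => Quotient.sound ⟨Bispan.idComp γ⟩
  comp_id f := Quotient.inductionOn f fun β => Quotient.sound ⟨Bispan.compId β⟩
  assoc f g h := Quotient.inductionOn₃ f g h fun β γ δ =>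
    Quotient.sound ⟨Bispan.compAssoc β γ δ⟩

/-- The morphisms of the polynomial category between two finite `G`-sets. -/
abbrev PolyHom (X Y : FinGSet G) : Type (u + 1) := @Quiver.Hom (PolyCat G) _ X Y

variable {X Y Z W : FinGSet G}

/-- The class of a bispan. -/
def Bispan.cls (β : Bispan X Y) : PolyHom X Y := Quotient.mk _ β

theorem Bispan.cls_eq {β γ : Bispan X Y} (e : BispanIso β γ) : β.cls = γ.cls :=
  Quotient.sound ⟨e⟩

/-- The transfer morphism `T_f = [X = X = X → Y]`. -/
def polyT (f : X →[G] Y) : PolyHom X Y :=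
  Bispan.cls ⟨X, X, MulActionHom.id G, MulActionHom.id G, f⟩

/-- The norm morphism `N_f = [X = X → Y = Y]`. -/
def polyN (f : X →[G] Y) : PolyHom X Y :=
  Bispan.cls ⟨X, Y, MulActionHom.id G, f, MulActionHom.id G⟩

/-- The restriction morphism `R_f = [Y ← X = X = X]`. -/
def polyR (f : X →[G] Y) : PolyHom Y X :=
  Bispan.cls ⟨X, X, f, MulActionHom.id G, MulActionHom.id G⟩

/-- An isomorphism of bispans from equivariant bijective maps. -/
noncomputable def BispanIso.ofBijective {β γ : Bispan X Y} (a : β.A →[G] γ.A) (b : β.B →[G] γ.B)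
    (ha : Function.Bijective a) (hb : Function.Bijective b)
    (r_comm : ∀ x : β.A, γ.r (a x) = β.r x)
    (n_comm : ∀ x : β.A, γ.n (a x) = b (β.n x))
    (t_comm : ∀ x : β.B, γ.t (b x) = β.t x) : BispanIso β γ where
  a := Equiv.ofBijective a ha
  b := Equiv.ofBijective b hb
  a_smul g x := map_smul a g x
  b_smul g x := map_smul b g x
  r_comm := r_comm
  n_comm := n_comm
  t_comm := t_comm

theorem polyCat_comp_T (A B : FinGSet G) (r : A →[G] X) (n : A →[G] B) (t : B →[G] Y)
    (f : Y →[G] Z) :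
    (Bispan.cls ⟨A, B, r, n, t⟩ ≫ polyT f : PolyHom X Z) =
      Bispan.cls ⟨A, B, r, n, f.comp t⟩ :=
  Bispan.cls_eq (Bispan.compTIso ⟨A, B, r, n, t⟩ f)

theorem polyCat_R_comp (A B : FinGSet G) (r : A →[G] Y) (n : A →[G] B) (t : B →[G] Z)
    (f : Y →[G] X) :
    (polyR f ≫ Bispan.cls ⟨A, B, r, n, t⟩ : PolyHom X Z) =
      Bispan.cls ⟨A, B, f.comp r, n, t⟩ :=
  Bispan.cls_eq (Bispan.compRIso f ⟨A, B, r, n, t⟩)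

theorem polyCat_comp_N (A : FinGSet G) (r : A →[G] X) (n : A →[G] Y) (f : Y →[G] Z) :
    (Bispan.cls ⟨A, Y, r, n, MulActionHom.id G⟩ ≫ polyN f : PolyHom X Z) =
      Bispan.cls ⟨A, Z, r, f.comp n, MulActionHom.id G⟩ := by
  symm
  let β : Bispan X Y := ⟨A, Y, r, n, MulActionHom.id G⟩
  let γ : Bispan Y Z := ⟨Y, Z, MulActionHom.id G, f, MulActionHom.id G⟩
  let b : Z → CompB β γ := fun z => ⟨z, fun c _ => c, fun _ _ => rfl⟩
  refine Bispan.cls_eq (BispanIso.ofBijective (γ := β.comp γ)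
    { toFun := fun a => (⟨b (f (n a)), n a, rfl, a, rfl⟩ : CompA β γ)
      map_smul' := fun g a => ?_ }
    { toFun := b
      map_smul' := fun g z => ?_ } ⟨fun a a' h => congrArg CompA.a h, fun x => ?_⟩
    ⟨fun z z' h => congrArg CompB.d h, fun x => ?_⟩ (fun _ => rfl) (fun _ => rfl) (fun _ => rfl))
  · refine CompA.ext' (CompB.ext' ?_ fun c hc hc' => ?_) (map_smul n g a) rfl
    · exact (congrArg f (map_smul n g a)).trans (map_smul f g (n a))
    · exact (smul_inv_smul g c).symm
  · exact CompB.ext' rfl fun c hc hc' => (smul_inv_smul g c).symm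
  · obtain ⟨⟨d, s, hs⟩, c, hc, a, ha⟩ := x
    have h : n a = c := ha.trans (hs c hc)
    subst h
    obtain rfl : f (n a) = d := hc
    exact ⟨a, CompA.ext' (CompB.ext' rfl fun c hc hc' => (hs c hc').symm) rfl rfl⟩
  · exact ⟨x.d, CompB.ext' rfl fun c hc hc' => (x.hs c hc').symm⟩

/-- The pullback of `A → B → Y` along `f : Z → Y`. -/
def Bispan.pull (β : Bispan X Y) (f : Z →[G] Y) : Bispan X Z :=
  letI : MulAction G {p : β.A × Z // β.t (β.n p.1) = f p.2} :=
    { smul := fun g p => ⟨(g • p.1.1, g • p.1.2), by simp only [map_smul, p.2]⟩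
      one_smul := fun p => Subtype.ext (one_smul G p.1)
      mul_smul := fun g h p => Subtype.ext (mul_smul g h p.1) }
  letI : MulAction G {p : β.B × Z // β.t p.1 = f p.2} :=
    { smul := fun g p => ⟨(g • p.1.1, g • p.1.2), by simp only [map_smul, p.2]⟩
      one_smul := fun p => Subtype.ext (one_smul G p.1)
      mul_smul := fun g h p => Subtype.ext (mul_smul g h p.1) }
  { A := ⟨{p : β.A × Z // β.t (β.n p.1) = f p.2}⟩
    B := ⟨{p : β.B × Z // β.t p.1 = f p.2}⟩
    r := { toFun := fun p => β.r p.1.1, map_smul' := fun g p => map_smul β.r g p.1.1 }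
    n :=
      { toFun := fun p => ⟨(β.n p.1.1, p.1.2), p.2⟩
        map_smul' := fun g p => Subtype.ext (Prod.ext (map_smul β.n g p.1.1) rfl) }
    t := { toFun := fun p => p.1.2, map_smul' := fun _ _ => rfl } }

theorem polyCat_comp_R (β : Bispan X Y) (f : Z →[G] Y) :
    (β.cls ≫ polyR f : PolyHom X Z) = (β.pull f).cls := by
  let γ : Bispan Y Z := ⟨Z, Z, f, MulActionHom.id G, MulActionHom.id G⟩
  refine Bispan.cls_eq (BispanIso.ofBijective (β := β.comp γ) (γ := β.pull f)
    { toFun := fun x : CompA β γ => ⟨(x.a, x.c), (congrArg β.t x.ha).trans (x.p.hs _ _)⟩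
      map_smul' := fun g x => rfl }
    { toFun := fun p : CompB β γ => ⟨(p.s p.d rfl, p.d), p.hs _ _⟩
      map_smul' := fun g p => ?_ } ⟨fun x y h => ?_, fun x => ?_⟩
    ⟨fun p q h => ?_, fun p => ?_⟩ (fun _ => rfl) (fun x => ?_) (fun _ => rfl))
  · exact Subtype.ext (Prod.ext (CompB.smul_s_smul g p p.d rfl rfl) rfl)
  · obtain ⟨⟨d, s, hs⟩, c, hc, a, ha⟩ := x
    obtain ⟨⟨d', s', hs'⟩, c', hc', a', ha'⟩ := y
    obtain rfl : c = d := hc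
    obtain rfl : c' = d' := hc'
    have h1 := Prod.ext_iff.1 (Subtype.ext_iff.1 h)
    obtain rfl : a = a' := h1.1
    obtain rfl : c = c' := h1.2
    refine CompA.ext' (CompB.ext' rfl fun z hz hz' => ?_) rfl rfl
    obtain rfl : z = c := hz
    exact ha.symm.trans ha'
  · obtain ⟨⟨a, z⟩, h⟩ := x
    exact ⟨⟨⟨z, fun _ _ => β.n a, fun c hc => h.trans (congrArg f (show c = z from hc).symm)⟩,
      z, rfl, a, rfl⟩, rfl⟩
  · have h1 := Prod.ext_iff.1 (Subtype.ext_iff.1 h)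
    obtain ⟨d, s, hs⟩ := p
    obtain ⟨d', s', hs'⟩ := q
    obtain rfl : d = d' := h1.2
    refine CompB.ext' rfl fun z hz hz' => ?_
    obtain rfl : z = d := hz
    exact h1.1
  · obtain ⟨⟨b, z⟩, h⟩ := p
    exact ⟨⟨z, fun _ _ => b, fun c hc => h.trans (congrArg f (show c = z from hc).symm)⟩, rfl⟩
  · obtain ⟨⟨d, s, hs⟩, c, hc, a, ha⟩ := x
    obtain rfl : c = d := hc
    exact Subtype.ext (Prod.ext ha rfl)

theorem polyT_comp (f : X →[G] Y) (g : Y →[G] Z) :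
    (polyT f ≫ polyT g : PolyHom X Z) = polyT (g.comp f) :=
  polyCat_comp_T _ _ _ _ _ _

theorem polyN_comp (f : X →[G] Y) (g : Y →[G] Z) :
    (polyN f ≫ polyN g : PolyHom X Z) = polyN (g.comp f) :=
  polyCat_comp_N _ _ _ _

theorem polyR_comp (f : X →[G] Y) (g : Y →[G] Z) :
    (polyR g ≫ polyR f : PolyHom Z X) = polyR (g.comp f) :=
  polyCat_R_comp _ _ _ _ _ _

/-- Every bispan is the composite of a restriction, a norm and a transfer. -/
theorem polyR_N_T (β : Bispan X Y) :
    ((polyR β.r ≫ polyN β.n : PolyHom X β.B) ≫ polyT β.t : PolyHom X Y) = β.cls := by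
  rw [polyN, polyCat_R_comp, polyCat_comp_T]
  rfl

/-- The square with `f' : P → X'`, `g' : P → X` over `g : X' → Y`, `f : X → Y` is cartesian. -/
structure IsCartesian {P X X' Y : FinGSet G} (f' : P →[G] X') (g' : P →[G] X) (g : X' →[G] Y)
    (f : X →[G] Y) : Prop where
  comm : ∀ p, g (f' p) = f (g' p)
  inj : ∀ p q, f' p = f' q → g' p = g' q → p = q
  surj : ∀ x' x, g x' = f x → ∃ p, f' p = x' ∧ g' p = x

theorem polyT_R {P X X' Y : FinGSet G} {f' : P →[G] X'} {g' : P →[G] X} {g : X' →[G] Y}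
    {f : X →[G] Y} (h : IsCartesian f' g' g f) :
    (polyT g ≫ polyR f : PolyHom X' X) = (polyR f' ≫ polyT g' : PolyHom X' X) := by
  rw [polyT, polyCat_comp_R, polyT, polyCat_R_comp]
  symm
  let φ : P →[G] (Bispan.pull ⟨X', X', MulActionHom.id G, MulActionHom.id G, g⟩ f).B :=
    { toFun := fun p => ⟨(f' p, g' p), h.comm p⟩
      map_smul' := fun m p => Subtype.ext (Prod.ext (map_smul f' m p) (map_smul g' m p)) }
  have hφ : Function.Bijective φ := by
    refine ⟨fun p q hpq => ?_, fun x => ?_⟩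
    · have h1 := Prod.ext_iff.1 (Subtype.ext_iff.1 hpq)
      exact h.inj p q h1.1 h1.2
    · obtain ⟨⟨x', x⟩, hx⟩ := x
      obtain ⟨p, rfl, rfl⟩ := h.surj x' x hx
      exact ⟨p, rfl⟩
  exact Bispan.cls_eq (BispanIso.ofBijective φ φ hφ hφ (fun _ => rfl) (fun _ => rfl)
    (fun _ => rfl))

theorem polyN_R {P X X' Y : FinGSet G} {f' : P →[G] X'} {g' : P →[G] X} {g : X' →[G] Y}
    {f : X →[G] Y} (h : IsCartesian f' g' g f) :
    (polyN g ≫ polyR f : PolyHom X' X) = (polyR f' ≫ polyN g' : PolyHom X' X) := by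
  rw [polyN, polyCat_comp_R, polyN, polyCat_R_comp]
  symm
  refine Bispan.cls_eq (BispanIso.ofBijective
    (γ := Bispan.pull ⟨X', Y, MulActionHom.id G, g, MulActionHom.id G⟩ f)
    { toFun := fun p => ⟨(f' p, g' p), h.comm p⟩
      map_smul' := fun m p => Subtype.ext (Prod.ext (map_smul f' m p) (map_smul g' m p)) }
    { toFun := fun x => ⟨(f x, x), rfl⟩
      map_smul' := fun m x => Subtype.ext (Prod.ext (map_smul f m x) rfl) }
    ⟨fun p q hpq => ?_, fun x => ?_⟩
    ⟨fun x y hxy => (Prod.ext_iff.1 (Subtype.ext_iff.1 hxy)).2, fun x => ?_⟩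
    (fun _ => rfl) (fun p => Subtype.ext (Prod.ext (h.comm p) rfl)) (fun _ => rfl))
  · have h1 := Prod.ext_iff.1 (Subtype.ext_iff.1 hpq)
    exact h.inj p q h1.1 h1.2
  · obtain ⟨⟨x', x⟩, hx⟩ := x
    obtain ⟨p, rfl, rfl⟩ := h.surj x' x hx
    exact ⟨p, rfl⟩
  · obtain ⟨⟨y, x⟩, hx⟩ := x
    obtain rfl : y = f x := hx
    exact ⟨x, rfl⟩

/-! ### Products in the polynomial category -/

/-- The bispan into a disjoint union with given components. -/
def Bispan.sum (β : Bispan Z X) (γ : Bispan Z Y) : Bispan Z (X.sum Y) :=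
  ⟨β.A.sum γ.A, β.B.sum γ.B, copair β.r γ.r, sumMap β.n γ.n, sumMap β.t γ.t⟩

/-- Disjoint unions of bispans respect isomorphism. -/
def Bispan.sumIso {β β' : Bispan Z X} {γ γ' : Bispan Z Y} (e : BispanIso β β')
    (f : BispanIso γ γ') : BispanIso (β.sum γ) (β'.sum γ') where
  a := Equiv.sumCongr e.a f.a
  b := Equiv.sumCongr e.b f.b
  a_smul g x := match x with
    | Sum.inl x => congrArg Sum.inl (e.a_smul g x)
    | Sum.inr x => congrArg Sum.inr (f.a_smul g x)
  b_smul g x := match x with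
    | Sum.inl x => congrArg Sum.inl (e.b_smul g x)
    | Sum.inr x => congrArg Sum.inr (f.b_smul g x)
  r_comm x := match x with
    | Sum.inl x => e.r_comm x
    | Sum.inr x => f.r_comm x
  n_comm x := match x with
    | Sum.inl x => congrArg Sum.inl (e.n_comm x)
    | Sum.inr x => congrArg Sum.inr (f.n_comm x)
  t_comm x := match x with
    | Sum.inl x => congrArg Sum.inl (e.t_comm x)
    | Sum.inr x => congrArg Sum.inr (f.t_comm x)

theorem Bispan.sum_equiv {β β' : Bispan Z X} {γ γ' : Bispan Z Y} (e : β ≈ β') (f : γ ≈ γ') :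
    β.sum γ ≈ β'.sum γ' :=
  ⟨Bispan.sumIso e.some f.some⟩

/-- The pairing of morphisms into a disjoint union. -/
def polyPair (f : PolyHom Z X) (g : PolyHom Z Y) : PolyHom Z (X.sum Y) :=
  Quotient.map₂ Bispan.sum (fun _ _ e _ _ f => Bispan.sum_equiv e f) f g

theorem polyPair_inl (f : PolyHom Z X) (g : PolyHom Z Y) :
    (polyPair f g ≫ polyR (inl X Y) : PolyHom Z X) = f := by
  refine Quotient.inductionOn₂ f g fun β γ => ?_
  refine (polyCat_comp_R (β.sum γ) (inl X Y)).trans (Eq.symm ?_)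
  refine Bispan.cls_eq (BispanIso.ofBijective (γ := (β.sum γ).pull (inl X Y))
    { toFun := fun a => ⟨(Sum.inl a, β.t (β.n a)), rfl⟩
      map_smul' := fun m a => Subtype.ext (Prod.ext rfl (by simp only [map_smul]; rfl)) }
    { toFun := fun b => ⟨(Sum.inl b, β.t b), rfl⟩
      map_smul' := fun m b => Subtype.ext (Prod.ext rfl (map_smul β.t m b)) }
    ⟨fun a a' h => Sum.inl_injective (Prod.ext_iff.1 (Subtype.ext_iff.1 h)).1, ?_⟩
    ⟨fun a a' h => Sum.inl_injective (Prod.ext_iff.1 (Subtype.ext_iff.1 h)).1, ?_⟩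
    (fun _ => rfl) (fun _ => rfl) (fun _ => rfl))
  · rintro ⟨⟨a | a, x⟩, h⟩
    · obtain rfl : β.t (β.n a) = x := Sum.inl_injective h
      exact ⟨a, rfl⟩
    · exact (Sum.inr_ne_inl h).elim
  · rintro ⟨⟨b | b, x⟩, h⟩
    · obtain rfl : β.t b = x := Sum.inl_injective h
      exact ⟨b, rfl⟩
    · exact (Sum.inr_ne_inl h).elim

theorem polyPair_inr (f : PolyHom Z X) (g : PolyHom Z Y) :
    (polyPair f g ≫ polyR (inr X Y) : PolyHom Z Y) = g := by
  refine Quotient.inductionOn₂ f g fun β γ => ?_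
  refine (polyCat_comp_R (β.sum γ) (inr X Y)).trans (Eq.symm ?_)
  refine Bispan.cls_eq (BispanIso.ofBijective (γ := (β.sum γ).pull (inr X Y))
    { toFun := fun a => ⟨(Sum.inr a, γ.t (γ.n a)), rfl⟩
      map_smul' := fun m a => Subtype.ext (Prod.ext rfl (by simp only [map_smul]; rfl)) }
    { toFun := fun b => ⟨(Sum.inr b, γ.t b), rfl⟩
      map_smul' := fun m b => Subtype.ext (Prod.ext rfl (map_smul γ.t m b)) }
    ⟨fun a a' h => Sum.inr_injective (Prod.ext_iff.1 (Subtype.ext_iff.1 h)).1, ?_⟩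
    ⟨fun a a' h => Sum.inr_injective (Prod.ext_iff.1 (Subtype.ext_iff.1 h)).1, ?_⟩
    (fun _ => rfl) (fun _ => rfl) (fun _ => rfl))
  · rintro ⟨⟨a | a, x⟩, h⟩
    · exact (Sum.inl_ne_inr h).elim
    · obtain rfl : γ.t (γ.n a) = x := Sum.inr_injective h
      exact ⟨a, rfl⟩
  · rintro ⟨⟨b | b, x⟩, h⟩
    · exact (Sum.inl_ne_inr h).elim
    · obtain rfl : γ.t b = x := Sum.inr_injective h
      exact ⟨b, rfl⟩

theorem polyPair_eta (h : PolyHom Z (X.sum Y)) :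
    polyPair (h ≫ polyR (inl X Y) : PolyHom Z X) (h ≫ polyR (inr X Y) : PolyHom Z Y) = h := by
  refine Quotient.inductionOn h fun β => ?_
  change polyPair (β.cls ≫ polyR (inl X Y) : PolyHom Z X)
    (β.cls ≫ polyR (inr X Y) : PolyHom Z Y) = β.cls
  rw [polyCat_comp_R, polyCat_comp_R]
  refine Bispan.cls_eq (BispanIso.ofBijective (β := (β.pull (inl X Y)).sum (β.pull (inr X Y)))
    { toFun := Sum.elim (fun p => p.1.1) (fun p => p.1.1)
      map_smul' := by rintro m (p | p) <;> rfl }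
    { toFun := Sum.elim (fun p => p.1.1) (fun p => p.1.1)
      map_smul' := by rintro m (p | p) <;> rfl }
    ⟨?_, fun a => ?_⟩ ⟨?_, fun b => ?_⟩ ?_ ?_ ?_)
  · rintro (⟨⟨a, x⟩, hx⟩ | ⟨⟨a, x⟩, hx⟩) (⟨⟨a', x'⟩, hx'⟩ | ⟨⟨a', x'⟩, hx'⟩) haa <;>
      obtain rfl : a = a' := haa
    · obtain rfl : x = x' := Sum.inl_injective (hx.symm.trans hx')
      rfl
    · exact (Sum.inl_ne_inr (hx.symm.trans hx')).elim
    · exact (Sum.inr_ne_inl (hx.symm.trans hx')).elim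
    · obtain rfl : x = x' := Sum.inr_injective (hx.symm.trans hx')
      rfl
  · obtain ⟨x, hx⟩ | ⟨x, hx⟩ : (∃ x, β.t (β.n a) = inl X Y x) ∨ ∃ x, β.t (β.n a) = inr X Y x := by
      rcases β.t (β.n a) with x | x
      exacts [Or.inl ⟨x, rfl⟩, Or.inr ⟨x, rfl⟩]
    · exact ⟨Sum.inl ⟨(a, x), hx⟩, rfl⟩
    · exact ⟨Sum.inr ⟨(a, x), hx⟩, rfl⟩
  · rintro (⟨⟨a, x⟩, hx⟩ | ⟨⟨a, x⟩, hx⟩) (⟨⟨a', x'⟩, hx'⟩ | ⟨⟨a', x'⟩, hx'⟩) haa <;>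
      obtain rfl : a = a' := haa
    · obtain rfl : x = x' := Sum.inl_injective (hx.symm.trans hx')
      rfl
    · exact (Sum.inl_ne_inr (hx.symm.trans hx')).elim
    · exact (Sum.inr_ne_inl (hx.symm.trans hx')).elim
    · obtain rfl : x = x' := Sum.inr_injective (hx.symm.trans hx')
      rfl
  · obtain ⟨x, hx⟩ | ⟨x, hx⟩ : (∃ x, β.t b = inl X Y x) ∨ ∃ x, β.t b = inr X Y x := by
      rcases β.t b with x | x
      exacts [Or.inl ⟨x, rfl⟩, Or.inr ⟨x, rfl⟩]
    · exact ⟨Sum.inl ⟨(b, x), hx⟩, rfl⟩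
    · exact ⟨Sum.inr ⟨(b, x), hx⟩, rfl⟩
  · rintro (p | p) <;> rfl
  · rintro (p | p) <;> rfl
  · rintro (⟨⟨b, x⟩, hx⟩ | ⟨⟨b, x⟩, hx⟩) <;> exact hx

/-- The disjoint union is the product in the polynomial category. -/
def polyIsLimit (X Y : FinGSet G) :
    Limits.IsLimit (Limits.BinaryFan.mk (C := PolyCat G) (P := X.sum Y)
      (polyR (inl X Y)) (polyR (inr X Y))) :=
  Limits.BinaryFan.IsLimit.mk _ (fun f g => polyPair f g) (fun f g => polyPair_inl f g)
    (fun f g => polyPair_inr f g) (fun f g m hf hg => by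
      subst hf hg
      exact (polyPair_eta m).symm)

/-- The empty `G`-set is terminal in the polynomial category. -/
def polyIsTerminal (G : Type u) [Group G] :
    Limits.IsTerminal (C := PolyCat G) (FinGSet.empty G) :=
  Limits.IsTerminal.ofUniqueHom
    (fun X => (polyR (bang X) : PolyHom X (FinGSet.empty G)))
    (fun X m => by
      refine Quotient.inductionOn m fun β => ?_
      have hB : IsEmpty β.B := ⟨fun b => isEmptyElim (β.t b)⟩
      have hA : IsEmpty β.A := ⟨fun a => isEmptyElim (β.n a)⟩
      exact Bispan.cls_eq
        { a := Equiv.equivOfIsEmpty _ _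
          b := Equiv.equivOfIsEmpty _ _
          a_smul := fun _ x => isEmptyElim x
          b_smul := fun _ x => isEmptyElim x
          r_comm := fun x => isEmptyElim x
          n_comm := fun x => isEmptyElim x
          t_comm := fun x => isEmptyElim x })

end Poly
/-! ## Tambara functors -/

/-- A semi-Tambara functor: a product-preserving functor from the polynomial category to sets. -/
structure SemiTambaraFunctor (G : Type u) [Group G] : Type (max (u + 1) (v + 1)) where
  toFunctor : PolyCat G ⥤ Type v
  preserves : Limits.PreservesFiniteProducts toFunctor

namespace SemiTambaraFunctor

variable {G : Type u} [Group G] (S : SemiTambaraFunctor.{u, v} G)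

/-- The value `S(X)` at a finite `G`-set. -/
def obj (X : FinGSet G) : Type v := S.toFunctor.obj X

variable {X Y Z W : FinGSet G}

/-- The function `S(X) → S(Y)` induced by a morphism of the polynomial category. -/
def map (f : PolyHom X Y) (x : S.obj X) : S.obj Y := S.toFunctor.map f x

/-- The transfer along `f`. -/
def tr (f : X →[G] Y) : S.obj X → S.obj Y := S.map (polyT f)

/-- The norm along `f`. -/
def nm (f : X →[G] Y) : S.obj X → S.obj Y := S.map (polyN f)

/-- The restriction along `f`. -/
def res (f : X →[G] Y) : S.obj Y → S.obj X := S.map (polyR f)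

theorem map_id (x : S.obj X) : S.map (𝟙 (X : PolyCat G)) x = x := by
  unfold map
  rw [S.toFunctor.map_id]
  rfl

theorem map_comp (f : PolyHom X Y) (g : PolyHom Y Z) (x : S.obj X) :
    S.map (f ≫ g : PolyHom X Z) x = S.map g (S.map f x) := by
  unfold map
  rw [S.toFunctor.map_comp]
  rfl

theorem res_id (x : S.obj X) : S.res (MulActionHom.id G) x = x := S.map_id x

theorem res_comp (f : X →[G] Y) (g : Y →[G] Z) (x : S.obj Z) :
    S.res (g.comp f) x = S.res f (S.res g x) := by
  rw [res, ← polyR_comp, map_comp]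
  rfl

theorem pair_bijective (X Y : FinGSet G) : Function.Bijective
    (fun x : S.obj (X.sum Y) => (S.res (inl X Y) x, S.res (inr X Y) x)) := by
  have := S.preserves
  let l := Limits.mapIsLimitOfPreservesOfIsLimit S.toFunctor _ _ (polyIsLimit X Y)
  let e := (Limits.IsLimit.conePointUniqueUpToIso l
    (Limits.Types.binaryProductLimit (S.obj X) (S.obj Y))).toEquiv
  exact e.bijective

/-- The canonical bijection `S(X ⨿ Y) ≃ S(X) × S(Y)`, given by the restrictions to `X` and `Y`. -/
noncomputable def pairEquiv (X Y : FinGSet G) : S.obj (X.sum Y) ≃ S.obj X × S.obj Y :=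
  Equiv.ofBijective _ (S.pair_bijective X Y)

/-- The element of `S(X ⨿ Y)` corresponding to `a ∈ S(X)` and `b ∈ S(Y)`. -/
noncomputable def pair (a : S.obj X) (b : S.obj Y) : S.obj (X.sum Y) :=
  (S.pairEquiv X Y).symm (a, b)

theorem res_inl_pair (a : S.obj X) (b : S.obj Y) : S.res (inl X Y) (S.pair a b) = a :=
  congrArg Prod.fst ((S.pairEquiv X Y).apply_symm_apply (a, b))

theorem res_inr_pair (a : S.obj X) (b : S.obj Y) : S.res (inr X Y) (S.pair a b) = b :=
  congrArg Prod.snd ((S.pairEquiv X Y).apply_symm_apply (a, b))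

theorem eq_pair {a : S.obj X} {b : S.obj Y} {x : S.obj (X.sum Y)} (h1 : S.res (inl X Y) x = a)
    (h2 : S.res (inr X Y) x = b) : x = S.pair a b :=
  ((S.pairEquiv X Y).eq_symm_apply).2 (Prod.ext h1 h2)

/-- `S(∅)` is a one-point set. -/
noncomputable instance instUniqueEmpty : Unique (S.obj (FinGSet.empty G)) :=
  have := S.preserves
  Limits.Types.isTerminalEquivUnique _ (Limits.IsTerminal.isTerminalObj S.toFunctor _
    (polyIsTerminal G))

/-- Covariant functoriality and base change: the common properties of transfers and norms. -/
structure IsCovariant (op : ∀ ⦃X Y : FinGSet G⦄, (X →[G] Y) → S.obj X → S.obj Y) : Prop where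
  id : ∀ ⦃X : FinGSet G⦄ (x : S.obj X), op (MulActionHom.id G) x = x
  comp : ∀ ⦃X Y Z : FinGSet G⦄ (f : X →[G] Y) (g : Y →[G] Z) (x : S.obj X),
    op (g.comp f) x = op g (op f x)
  base : ∀ ⦃P X X' Y : FinGSet G⦄ (f' : P →[G] X') (g' : P →[G] X) (g : X' →[G] Y)
    (f : X →[G] Y), IsCartesian f' g' g f → ∀ x, S.res f (op g x) = op g' (S.res f' x)

theorem isCovariant_tr : S.IsCovariant (fun _ _ f => S.tr f) where
  id _ x := S.map_id x
  comp _ _ _ f g x := by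
    rw [tr, ← polyT_comp, map_comp]
    rfl
  base _ _ _ _ f' g' g f h x := by
    rw [res, tr, ← map_comp, polyT_R h, map_comp]
    rfl

theorem isCovariant_nm : S.IsCovariant (fun _ _ f => S.nm f) where
  id _ x := S.map_id x
  comp _ _ _ f g x := by
    rw [nm, ← polyN_comp, map_comp]
    rfl
  base _ _ _ _ f' g' g f h x := by
    rw [res, nm, ← map_comp, polyN_R h, map_comp]
    rfl

namespace IsCovariant

variable {S} {op : ∀ ⦃X Y : FinGSet G⦄, (X →[G] Y) → S.obj X → S.obj Y}

theorem sumMap_pair (hop : S.IsCovariant op) {X' Y' : FinGSet G} (f : X →[G] X') (g : Y →[G] Y') (a : S.obj X)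
    (b : S.obj Y) : op (sumMap f g) (S.pair a b) = S.pair (op f a) (op g b) := by
  apply S.eq_pair
  · rw [hop.base (inl X Y) f (sumMap f g) (inl X' Y'), res_inl_pair]
    refine ⟨fun _ => rfl, fun p q h _ => Sum.inl_injective h, ?_⟩
    rintro (x | x) y h
    · exact ⟨x, rfl, Sum.inl_injective h⟩
    · exact (Sum.inr_ne_inl h).elim
  · rw [hop.base (inr X Y) g (sumMap f g) (inr X' Y'), res_inr_pair]
    refine ⟨fun _ => rfl, fun p q h _ => Sum.inr_injective h, ?_⟩
    rintro (x | x) y h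
    · exact (Sum.inl_ne_inr h).elim
    · exact ⟨x, rfl, Sum.inr_injective h⟩

theorem of_inverse (hop : S.IsCovariant op) (e : X →[G] Y) (e' : Y →[G] X) (h : ∀ x, e' (e x) = x)
    (h' : ∀ y, e (e' y) = y) (x : S.obj X) : op e x = S.res e' x := by
  rw [← S.res_id (op e x), hop.base e' (MulActionHom.id G) e (MulActionHom.id G), hop.id]
  refine ⟨h', fun p q _ hpq => hpq, fun x' y hxy => ⟨y, ?_, rfl⟩⟩
  obtain rfl : e x' = y := hxy
  exact h x'

theorem assoc (hop : S.IsCovariant op) (a b c : S.obj X) :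
    op (fold X) (S.pair (op (fold X) (S.pair a b)) c) =
      op (fold X) (S.pair a (op (fold X) (S.pair b c))) := by
  let α : (X.sum X).sum X →[G] X.sum (X.sum X) :=
    copair (copair (inl _ _) ((inr _ _).comp (inl _ _))) ((inr _ _).comp (inr _ _))
  let α' : X.sum (X.sum X) →[G] (X.sum X).sum X :=
    copair ((inl _ _).comp (inl _ _)) (copair ((inl _ _).comp (inr _ _)) (inr _ _))
  have h1 : op α (S.pair (S.pair a b) c) = S.pair a (S.pair b c) := by
    rw [hop.of_inverse α α' (by rintro ((x | x) | x) <;> rfl) (by rintro (x | x | x) <;> rfl)]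
    refine S.eq_pair ?_ (S.eq_pair ?_ ?_)
    · rw [← res_comp]
      change S.res ((inl _ _).comp (inl _ _)) _ = _
      rw [res_comp, res_inl_pair, res_inl_pair]
    · rw [← res_comp, ← res_comp]
      change S.res ((inl _ _).comp (inr _ _)) _ = _
      rw [res_comp, res_inl_pair, res_inr_pair]
    · rw [← res_comp, ← res_comp]
      change S.res (inr _ _) _ = _
      rw [res_inr_pair]
  calc op (fold X) (S.pair (op (fold X) (S.pair a b)) c)
      = op (fold X) (op (sumMap (fold X) (MulActionHom.id G)) (S.pair (S.pair a b) c)) := by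
        rw [hop.sumMap_pair, hop.id]
    _ = op (fold X) (op (sumMap (MulActionHom.id G) (fold X)) (op α (S.pair (S.pair a b) c))) := by
        rw [← hop.comp, ← hop.comp, ← hop.comp]
        congr 1
        ext x
        obtain (x | x) | x := x <;> rfl
    _ = _ := by rw [h1, hop.sumMap_pair, hop.id]

theorem comm (hop : S.IsCovariant op) (a b : S.obj X) : op (fold X) (S.pair a b) = op (fold X) (S.pair b a) := by
  let σ : X.sum X →[G] X.sum X := copair (inr _ _) (inl _ _)
  have h1 : op σ (S.pair a b) = S.pair b a := by
    rw [hop.of_inverse σ σ (by rintro (x | x) <;> rfl) (by rintro (x | x) <;> rfl)]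
    refine S.eq_pair ?_ ?_
    · rw [← res_comp]
      exact S.res_inr_pair a b
    · rw [← res_comp]
      exact S.res_inl_pair a b
  rw [← h1, ← hop.comp]
  congr 1
  ext x
  obtain x | x := x <;> rfl

theorem unit (hop : S.IsCovariant op) (a : S.obj X) : op (fold X) (S.pair (op (bang X) default) a) = a := by
  have h1 : S.pair (op (bang X) default) a =
      op (sumMap (bang X) (MulActionHom.id G)) (S.pair default a) := by
    rw [hop.sumMap_pair, hop.id]
  rw [h1, ← hop.comp, hop.of_inverse _ (inr _ _), res_inr_pair]
  · rintro (x | x)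
    · exact isEmptyElim x
    · rfl
  · exact fun _ => rfl

end IsCovariant

/-- The sections of `∇ ⨿ id : (X ⨿ X) ⨿ X → X ⨿ X` over the fibres of `∇ : X ⨿ X → X`. -/
theorem polyT_N_fold (X : FinGSet G) :
    (polyT (sumMap (fold X) (MulActionHom.id G)) ≫ polyN (fold X) :
      PolyHom ((X.sum X).sum X) X) =
    ((polyR (copair (sumMap (inl X X) (MulActionHom.id G))
        (sumMap (inr X X) (MulActionHom.id G))) ≫
      polyN (sumMap (fold X) (fold X)) : PolyHom ((X.sum X).sum X) (X.sum X)) ≫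
      polyT (fold X) : PolyHom ((X.sum X).sum X) X) := by
  refine Eq.trans ?_ (polyR_N_T (⟨_, _, copair (sumMap (inl X X) (MulActionHom.id G))
    (sumMap (inr X X) (MulActionHom.id G)), sumMap (fold X) (fold X), fold X⟩ :
      Bispan ((X.sum X).sum X) X)).symm
  symm
  let β : Bispan ((X.sum X).sum X) (X.sum X) :=
    ⟨_, _, MulActionHom.id G, MulActionHom.id G, sumMap (fold X) (MulActionHom.id G)⟩
  let γ : Bispan (X.sum X) X := ⟨_, _, MulActionHom.id G, fold X, MulActionHom.id G⟩
  let i : X.sum X →[G] (X.sum X).sum X := sumMap (inl X X) (MulActionHom.id G)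
  let j : X.sum X →[G] (X.sum X).sum X := sumMap (inr X X) (MulActionHom.id G)
  let p : X → CompB β γ := fun x => ⟨x, fun c _ => i c, by rintro (c | c) _ <;> rfl⟩
  let q : X → CompB β γ := fun x => ⟨x, fun c _ => j c, by rintro (c | c) _ <;> rfl⟩
  have hp : ∀ (g : G) (x : X), p (g • x) = g • p x := fun g x =>
    CompB.ext' rfl fun c _ _ => by
      change i c = g • i (g⁻¹ • c)
      rw [← map_smul, smul_inv_smul]
  have hq : ∀ (g : G) (x : X), q (g • x) = g • q x := fun g x =>
    CompB.ext' rfl fun c _ _ => by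
      change j c = g • j (g⁻¹ • c)
      rw [← map_smul, smul_inv_smul]
  have hpq : ∀ x y, p x ≠ q y := fun x y h => by
    obtain rfl : x = y := congrArg CompB.d h
    have h1 : i (inl X X x) = j (inl X X x) := CompB.s_congr h rfl rfl rfl
    exact Sum.inl_ne_inr (Sum.inl_injective h1)
  let b : (X.sum X).carrier → CompB β γ := Sum.elim p q
  have hb : Function.Bijective b := by
    refine ⟨?_, fun z => ?_⟩
    · rintro (x | x) (y | y) h
      · exact congrArg Sum.inl (congrArg CompB.d h)
      · exact (hpq _ _ h).elim
      · exact (hpq _ _ h.symm).elim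
      · exact congrArg Sum.inr (congrArg CompB.d h)
    · obtain ⟨d, s, hs⟩ := z
      have h2 : s (inr X X d) rfl = Sum.inr d := by
        have := hs (inr X X d) rfl
        rcases hh : s (inr X X d) rfl with y | y
        · rw [hh] at this
          exact (Sum.inl_ne_inr this).elim
        · rw [hh] at this
          exact congrArg Sum.inr (Sum.inr_injective this)
      have h1 := hs (inl X X d) rfl
      rcases hh : s (inl X X d) rfl with (y | y) | y
      · rw [hh] at h1
        obtain rfl : y = d := Sum.inl_injective h1
        refine ⟨Sum.inl y, CompB.ext' rfl ?_⟩
        rintro (c | c) hc hc'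
        · obtain rfl : c = y := hc
          exact hh.symm
        · obtain rfl : c = y := hc
          exact h2.symm
      · rw [hh] at h1
        obtain rfl : y = d := Sum.inl_injective h1
        refine ⟨Sum.inr y, CompB.ext' rfl ?_⟩
        rintro (c | c) hc hc'
        · obtain rfl : c = y := hc
          exact hh.symm
        · obtain rfl : c = y := hc
          exact h2.symm
      · rw [hh] at h1
        exact (Sum.inr_ne_inl h1).elim
  let a : ((X.sum X).sum (X.sum X)).carrier → CompA β γ :=
    Sum.elim (fun c => ⟨p (fold X c), c, rfl, i c, rfl⟩) (fun c => ⟨q (fold X c), c, rfl, j c, rfl⟩)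
  refine Bispan.cls_eq (BispanIso.ofBijective (γ := β.comp γ)
    { toFun := a
      map_smul' := ?_ }
    { toFun := b
      map_smul' := ?_ } ⟨?_, fun z => ?_⟩ hb ?_ ?_ ?_)
  · rintro g (c | c)
    · exact CompA.ext' ((congrArg p (map_smul (fold X) g c)).trans (hp g _)) rfl (map_smul i g c)
    · exact CompA.ext' ((congrArg q (map_smul (fold X) g c)).trans (hq g _)) rfl (map_smul j g c)
  · rintro g (x | x)
    · exact hp g x
    · exact hq g x
  · rintro (x | x) (y | y) h
    · exact congrArg Sum.inl (congrArg CompA.c h)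
    · exact (hpq _ _ (congrArg CompA.p h)).elim
    · exact (hpq _ _ (congrArg CompA.p h).symm).elim
    · exact congrArg Sum.inr (congrArg CompA.c h)
  · obtain ⟨z, c, hc, y, hy⟩ := z
    obtain ⟨x | x, rfl⟩ := hb.2 z
    · obtain rfl : fold X c = x := hc
      exact ⟨Sum.inl c, CompA.ext' rfl rfl hy.symm⟩
    · obtain rfl : fold X c = x := hc
      exact ⟨Sum.inr c, CompA.ext' rfl rfl hy.symm⟩
  · rintro (c | c) <;> rfl
  · rintro (c | c) <;> rfl
  · rintro (c | c) <;> rfl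

/-- The map `! ⨿ id : ∅ ⨿ X → X ⨿ X` has no section over the fibres of `∇ : X ⨿ X → X`. -/
theorem polyT_N_bang (X : FinGSet G) :
    (polyT (sumMap (bang X) (MulActionHom.id G)) ≫ polyN (fold X) :
      PolyHom ((FinGSet.empty G).sum X) X) =
    (polyR (bang _) ≫ polyT (bang X) : PolyHom ((FinGSet.empty G).sum X) X) := by
  rw [polyT, polyT, polyCat_R_comp]
  let β : Bispan ((FinGSet.empty G).sum X) (X.sum X) :=
    ⟨_, _, MulActionHom.id G, MulActionHom.id G, sumMap (bang X) (MulActionHom.id G)⟩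
  let γ : Bispan (X.sum X) X := ⟨_, _, MulActionHom.id G, fold X, MulActionHom.id G⟩
  have hB : IsEmpty (CompB β γ) := ⟨fun z => by
    have h1 := z.hs (inl X X z.d) rfl
    rcases hh : z.s (inl X X z.d) rfl with y | y
    · exact isEmptyElim y
    · rw [hh] at h1
      exact (Sum.inr_ne_inl h1).elim⟩
  have hA : IsEmpty (CompA β γ) := ⟨fun z => isEmptyElim z.p⟩
  exact Bispan.cls_eq (β := β.comp γ)
    { a := @Equiv.equivOfIsEmpty (CompA β γ) _ _ _
      b := @Equiv.equivOfIsEmpty (CompB β γ) _ _ _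
      a_smul := fun _ x => hA.elim x
      b_smul := fun _ x => hB.elim x
      r_comm := fun x => hA.elim x
      n_comm := fun x => hA.elim x
      t_comm := fun x => hB.elim x }

/-- `0_X` is the image of the point under the transfer along `∅ → X`. -/
noncomputable instance instZero (X : FinGSet G) : Zero (S.obj X) := ⟨S.tr (bang X) default⟩

/-- `1_X` is the image of the point under the norm along `∅ → X`. -/
noncomputable instance instOne (X : FinGSet G) : One (S.obj X) := ⟨S.nm (bang X) default⟩

/-- Addition is the transfer along the fold map. -/
noncomputable instance instAdd (X : FinGSet G) : Add (S.obj X) :=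
  ⟨fun a b => S.tr (fold X) (S.pair a b)⟩

/-- Multiplication is the norm along the fold map. -/
noncomputable instance instMul (X : FinGSet G) : Mul (S.obj X) :=
  ⟨fun a b => S.nm (fold X) (S.pair a b)⟩

theorem add_def (a b : S.obj X) : a + b = S.tr (fold X) (S.pair a b) := rfl

theorem mul_def (a b : S.obj X) : a * b = S.nm (fold X) (S.pair a b) := rfl

theorem zero_def (X : FinGSet G) : (0 : S.obj X) = S.tr (bang X) default := rfl

theorem one_def (X : FinGSet G) : (1 : S.obj X) = S.nm (bang X) default := rfl

theorem add_mul' (a b c : S.obj X) : (a + b) * c = a * c + b * c := by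
  have h1 : S.pair (a + b) c =
      S.tr (sumMap (fold X) (MulActionHom.id G)) (S.pair (S.pair a b) c) := by
    rw [S.isCovariant_tr.sumMap_pair, S.isCovariant_tr.id]
    rfl
  have h2 : S.res (copair (sumMap (inl X X) (MulActionHom.id G))
      (sumMap (inr X X) (MulActionHom.id G))) (S.pair (S.pair a b) c) =
      S.pair (S.pair a c) (S.pair b c) := by
    refine S.eq_pair (S.eq_pair ?_ ?_) (S.eq_pair ?_ ?_)
    · rw [← res_comp, ← res_comp]
      change S.res ((inl _ _).comp (inl _ _)) _ = _
      rw [res_comp, res_inl_pair, res_inl_pair]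
    · rw [← res_comp, ← res_comp]
      change S.res (inr _ _) _ = _
      rw [res_inr_pair]
    · rw [← res_comp, ← res_comp]
      change S.res ((inl _ _).comp (inr _ _)) _ = _
      rw [res_comp, res_inl_pair, res_inr_pair]
    · rw [← res_comp, ← res_comp]
      change S.res (inr _ _) _ = _
      rw [res_inr_pair]
  rw [mul_def, h1, nm, tr, ← map_comp, polyT_N_fold, map_comp, map_comp]
  change S.tr (fold X) (S.nm _ (S.res _ _)) = _
  rw [h2, S.isCovariant_nm.sumMap_pair]
  rfl

theorem zero_mul' (a : S.obj X) : 0 * a = 0 := by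
  have h1 : S.pair 0 a = S.tr (sumMap (bang X) (MulActionHom.id G)) (S.pair default a) := by
    rw [S.isCovariant_tr.sumMap_pair, S.isCovariant_tr.id]
    rfl
  rw [mul_def, h1, nm, tr, ← map_comp, polyT_N_bang, map_comp]
  exact congrArg (S.tr (bang X)) (Subsingleton.elim _ _)

/-- The commutative semiring structure on `S(X)`. -/
noncomputable instance instCommSemiring (X : FinGSet G) : CommSemiring (S.obj X) where
  add_assoc a b c := S.isCovariant_tr.assoc a b c
  zero_add a := S.isCovariant_tr.unit a
  add_zero a := (S.isCovariant_tr.comm a 0).trans (S.isCovariant_tr.unit a)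
  add_comm a b := S.isCovariant_tr.comm a b
  nsmul := nsmulRec
  mul_assoc a b c := S.isCovariant_nm.assoc a b c
  one_mul a := S.isCovariant_nm.unit a
  mul_one a := (S.isCovariant_nm.comm a 1).trans (S.isCovariant_nm.unit a)
  mul_comm a b := S.isCovariant_nm.comm a b
  left_distrib a b c := by
    have h : ∀ x y : S.obj X, x * y = y * x := fun x y => S.isCovariant_nm.comm x y
    rw [h, add_mul', h b, h c]
  right_distrib a b c := S.add_mul' a b c
  zero_mul a := S.zero_mul' a
  mul_zero a := by
    have h : ∀ x y : S.obj X, x * y = y * x := fun x y => S.isCovariant_nm.comm x y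
    rw [h, zero_mul']

end SemiTambaraFunctor

/-- A Tambara functor: a semi-Tambara functor `S` such that every element of the commutative
semiring `S(X)` has an additive inverse, for all finite `G`-sets `X`. -/
structure TambaraFunctor (G : Type u) [Group G] : Type (max (u + 1) (v + 1)) extends
    SemiTambaraFunctor.{u, v} G where
  exists_neg : ∀ (X : FinGSet G) (a : toSemiTambaraFunctor.obj X), ∃ b, a + b = 0

/-- A choice of additive inverses, which are unique. -/
noncomputable instance TambaraFunctor.instNeg {G : Type u} [Group G]
    (T : TambaraFunctor.{u, v} G) (X : FinGSet G) : Neg (T.obj X) :=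
  ⟨fun a => (T.exists_neg X a).choose⟩

/-- The commutative ring structure on `T(X)`. -/
noncomputable instance TambaraFunctor.instCommRing {G : Type u} [Group G]
    (T : TambaraFunctor.{u, v} G) (X : FinGSet G) : CommRing (T.obj X) where
  __ := T.instCommSemiring X
  zsmul := zsmulRec
  neg_add_cancel a := (add_comm _ _).trans (T.exists_neg X a).choose_spec

/-! ## Tambara ideals -/

noncomputable section Ideals

variable {G : Type u} [Group G] [Finite G]

/-- The quotient map `G/H → G/K`, `xH ↦ xK`, for `H ≤ K`. -/
def orbitProj {H K : Subgroup G} (h : H ≤ K) : FinGSet.orbit H →[G] FinGSet.orbit K where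
  toFun := Subgroup.quotientMapOfLE h
  map_smul' _ x := Quotient.inductionOn' x fun _ => rfl

/-- The conjugate subgroup `gHg⁻¹`. -/
abbrev conjSubgroup (g : G) (H : Subgroup G) : Subgroup G := H.map (MulAut.conj g).toMonoidHom

/-- The isomorphism `G/H → G/gHg⁻¹`, `xH ↦ xg⁻¹(gHg⁻¹)`. -/
def orbitConj (g : G) (H : Subgroup G) :
    FinGSet.orbit H →[G] FinGSet.orbit (conjSubgroup g H) where
  toFun := Quotient.map' (fun x : G => x * g⁻¹) (fun x y h => by
    rw [QuotientGroup.leftRel_apply] at h ⊢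
    exact ⟨x⁻¹ * y, h, by simp [mul_assoc]⟩)
  map_smul' m x := Quotient.inductionOn' x fun x =>
    congrArg (fun z : G => (QuotientGroup.mk z : G ⧸ conjSubgroup g H)) (mul_assoc m x g⁻¹)

variable (T : TambaraFunctor.{u, v} G)

/-- The level `T(G/H)`. -/
abbrev TambaraFunctor.level (H : Subgroup G) : Type v := T.obj (FinGSet.orbit H)

/-- A Tambara ideal: ideals `I(G/H) ⊆ T(G/H)` for all `H ≤ G` which are closed under restrictions,
transfers, norms and conjugations. -/
@[ext]
structure TambaraIdeal : Type (max u v) where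
  ideal : ∀ H : Subgroup G, Ideal (T.level H)
  res_mem : ∀ (H K : Subgroup G) (h : H ≤ K) (x : T.level K),
    x ∈ ideal K → T.res (orbitProj h) x ∈ ideal H
  tr_mem : ∀ (H K : Subgroup G) (h : H ≤ K) (x : T.level H),
    x ∈ ideal H → T.tr (orbitProj h) x ∈ ideal K
  nm_mem : ∀ (H K : Subgroup G) (h : H ≤ K) (x : T.level H),
    x ∈ ideal H → T.nm (orbitProj h) x ∈ ideal K
  conj_mem : ∀ (g : G) (H : Subgroup G) (x : T.level H),
    x ∈ ideal H → T.tr (orbitConj g H) x ∈ ideal (conjSubgroup g H)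

namespace TambaraIdeal

variable {T}

/-- Levelwise inclusion. -/
instance instLE : LE (TambaraIdeal T) := ⟨fun I J => ∀ H, I.ideal H ≤ J.ideal H⟩

/-- The ideal consisting of all elements of `T`. -/
instance instTop : Top (TambaraIdeal T) where
  top :=
    { ideal := fun _ => ⊤
      res_mem := fun _ _ _ _ _ => Submodule.mem_top
      tr_mem := fun _ _ _ _ _ => Submodule.mem_top
      nm_mem := fun _ _ _ _ _ => Submodule.mem_top
      conj_mem := fun _ _ _ _ => Submodule.mem_top }

/-- The levelwise intersection of a set of ideals. -/
instance instInfSet : InfSet (TambaraIdeal T) where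
  sInf s :=
    { ideal := fun H => ⨅ I ∈ s, I.ideal H
      res_mem := fun H K h x hx => by
        simp only [Submodule.mem_iInf] at hx ⊢
        exact fun I hI => I.res_mem H K h x (hx I hI)
      tr_mem := fun H K h x hx => by
        simp only [Submodule.mem_iInf] at hx ⊢
        exact fun I hI => I.tr_mem H K h x (hx I hI)
      nm_mem := fun H K h x hx => by
        simp only [Submodule.mem_iInf] at hx ⊢
        exact fun I hI => I.nm_mem H K h x (hx I hI)
      conj_mem := fun g H x hx => by
        simp only [Submodule.mem_iInf] at hx ⊢
        exact fun I hI => I.conj_mem g H x (hx I hI) }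

theorem mem_sInf {s : Set (TambaraIdeal T)} {H : Subgroup G} {x : T.level H} :
    x ∈ (sInf s).ideal H ↔ ∀ I ∈ s, x ∈ I.ideal H := by
  change x ∈ (⨅ I ∈ s, I.ideal H) ↔ _
  simp only [Submodule.mem_iInf]

/-- The product `IJ`: the intersection of all ideals `K` such that
`I(G/H) · J(G/H) ⊆ K(G/H)` for all `H ≤ G`. -/
instance instMul : Mul (TambaraIdeal T) where
  mul I J := sInf {K | ∀ H, I.ideal H * J.ideal H ≤ K.ideal H}

theorem mul_def (I J : TambaraIdeal T) :
    I * J = sInf {K | ∀ H, I.ideal H * J.ideal H ≤ K.ideal H} := rfl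

/-- The smallest ideal of `T` which contains `f ∈ T(G/H)`. -/
def span {H : Subgroup G} (f : T.level H) : TambaraIdeal T := sInf {I | f ∈ I.ideal H}

theorem span_le {H : Subgroup G} {f : T.level H} {I : TambaraIdeal T} :
    span f ≤ I ↔ f ∈ I.ideal H :=
  ⟨fun h => h H (mem_sInf.2 fun _ hJ => hJ), fun h _ _ hx => mem_sInf.1 hx I h⟩

/-- An ideal `P` is prime if it is proper and `IJ ⊆ P` implies `I ⊆ P` or `J ⊆ P`. -/
structure IsPrime (P : TambaraIdeal T) : Prop where
  ne_top : P ≠ ⊤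
  le_or_le : ∀ I J : TambaraIdeal T, I * J ≤ P → I ≤ P ∨ J ≤ P

end TambaraIdeal

/-! ## The Nakaoka spectrum -/

/-- The set of prime ideals of a Tambara functor. -/
structure Spec : Type (max u v) where
  asIdeal : TambaraIdeal T
  isPrime : asIdeal.IsPrime

namespace Spec

variable {T}

/-- `V(I)` is the set of prime ideals which contain `I`. -/
def zeroLocus (I : TambaraIdeal T) : Set (Spec T) := {P | I ≤ P.asIdeal}

theorem zeroLocus_top : zeroLocus (⊤ : TambaraIdeal T) = ∅ := by
  refine Set.eq_empty_of_forall_notMem fun P hP => P.isPrime.ne_top ?_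
  exact TambaraIdeal.ext (funext fun H => top_le_iff.1 (hP H))

theorem zeroLocus_mul (I J : TambaraIdeal T) :
    zeroLocus I ∪ zeroLocus J = zeroLocus (I * J) := by
  ext P
  constructor
  · rintro (h | h) H x hx
    · exact h H (TambaraIdeal.mem_sInf.1 hx I fun _ => Ideal.mul_le_left)
    · exact h H (TambaraIdeal.mem_sInf.1 hx J fun _ => Ideal.mul_le_right)
  · exact P.isPrime.le_or_le I J

theorem zeroLocus_sInter (A : Set (Set (Spec T))) (hA : A ⊆ Set.range zeroLocus) :
    ⋂₀ A ∈ Set.range (zeroLocus (T := T)) := by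
  refine ⟨sInf {K | ∀ I, zeroLocus I ∈ A → I ≤ K}, Set.ext fun P => ⟨fun h s hs => ?_, ?_⟩⟩
  · obtain ⟨I, rfl⟩ := hA hs
    exact fun H x hx => h H (TambaraIdeal.mem_sInf.2 fun K hK => hK I hs H hx)
  · exact fun h H x hx => TambaraIdeal.mem_sInf.1 hx P.asIdeal fun I hI => h _ hI

/-- The closed sets are the sets `V(I)`, for `I` an ideal of `T`. -/
instance instTopologicalSpace : TopologicalSpace (Spec T) :=
  TopologicalSpace.ofClosed (Set.range zeroLocus) ⟨⊤, zeroLocus_top⟩ zeroLocus_sInter (by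
    rintro _ ⟨I, rfl⟩ _ ⟨J, rfl⟩
    exact ⟨I * J, (zeroLocus_mul I J).symm⟩)

theorem isClosed_zeroLocus (I : TambaraIdeal T) : IsClosed (zeroLocus I) := by
  rw [← isOpen_compl_iff]
  change (zeroLocus I)ᶜᶜ ∈ Set.range zeroLocus
  rw [compl_compl]
  exact ⟨I, rfl⟩

/-- The basic open set `D(f)` of prime ideals which do not contain `f ∈ T(G/H)`. -/
def basicOpen {H : Subgroup G} (f : T.level H) : TopologicalSpace.Opens (Spec T) where
  carrier := {P | f ∉ P.asIdeal.ideal H}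
  is_open' := by
    have h : {P : Spec T | f ∉ P.asIdeal.ideal H} = (zeroLocus (TambaraIdeal.span f))ᶜ := by
      ext P
      exact not_congr TambaraIdeal.span_le.symm
    rw [h]
    exact (isClosed_zeroLocus _).isOpen_compl

end Spec

end Ideals
end Tambara

/-! The proof shows that every ultrafilter `U` on the spectrum converges to the prime whose elements
are those lying in `Q` for `U`-almost all primes `Q` (`eventualIdeal`). If `U` contains D(f), then f
is almost always outside `Q`, so f is not in this limit, which therefore lies in D(f). This is the
ultrafilter criterion for compactness.

The limit is plainly an ideal; the issue is that it is prime. Primality quantifies over all pairs of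
ideals, which an ultrafilter cannot handle directly. It is replaced by Nakaoka's elementwise
criterion `IsPrime.mem_or_mem`: in a prime P, if all products of a multiplicative translate
nm_v(res_w a) with a multiplicative translate of b are in P, then a or b is in P. Since G is finite,
there are finitely many subgroups and maps of orbits, hence finitely many such products, and "for
almost all Q, all products" follows from "for each product, almost all Q".

The criterion rests on colon ideals. For a family N stable under restriction, the elements whose
multiplicative translates all multiply N into P form an ideal `colon`. All closure conditions come
from one statement, `TranslatesMulMem.map`: the property survives every bispan whose norm leg is
surjective. The projection formula moves the factor from N under the transfer, base change reduces
to norms over nonempty G-sets, and such a norm has an orbit norm as a factor. With B the colon of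
the translates of a, and A the colon of B, one has a in A, AB inside P, and b in B by hypothesis;
primality finishes. -/

namespace Tambara

/-! ### Pullbacks, complements and a distributivity relation for bispans. -/

section GSets

variable {G : Type u} [Group G]

/-- The pullback of two equivariant maps. -/
def FinGSet.pullback {X Y Z : FinGSet G} (f : X →[G] Z) (g : Y →[G] Z) : FinGSet G :=
  letI : MulAction G {p : X × Y // f p.1 = g p.2} :=
    { smul := fun m p => ⟨(m • p.1.1, m • p.1.2), by simp only [map_smul, p.2]⟩
      one_smul := fun p => Subtype.ext (one_smul G p.1)
      mul_smul := fun m n p => Subtype.ext (mul_smul m n p.1) }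
  ⟨{p : X × Y // f p.1 = g p.2}⟩

/-- The first projection of the pullback. -/
def pullbackFst {X Y Z : FinGSet G} (f : X →[G] Z) (g : Y →[G] Z) :
    FinGSet.pullback f g →[G] X where
  toFun p := p.1.1
  map_smul' _ _ := rfl

/-- The second projection of the pullback. -/
def pullbackSnd {X Y Z : FinGSet G} (f : X →[G] Z) (g : Y →[G] Z) :
    FinGSet.pullback f g →[G] Y where
  toFun p := p.1.2
  map_smul' _ _ := rfl

theorem isCartesian_pullback {X Y Z : FinGSet G} (f : X →[G] Z) (g : Y →[G] Z) :
    IsCartesian (pullbackFst f g) (pullbackSnd f g) f g where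
  comm p := p.2
  inj _ _ h1 h2 := Subtype.ext (Prod.ext h1 h2)
  surj x y h := ⟨⟨(x, y), h⟩, rfl, rfl⟩

/-- The complement of the range of an equivariant map. -/
def FinGSet.compl {X D : FinGSet G} (i : X →[G] D) : FinGSet G :=
  letI : MulAction G {d : D // d ∉ Set.range i} :=
    { smul := fun m d => ⟨m • d.1, fun ⟨x, hx⟩ => d.2 ⟨m⁻¹ • x, by
        rw [map_smul, hx, inv_smul_smul]⟩⟩
      one_smul := fun d => Subtype.ext (one_smul G d.1)
      mul_smul := fun m n d => Subtype.ext (mul_smul m n d.1) }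
  ⟨{d : D // d ∉ Set.range i}⟩

/-- The inclusion of the complement of the range of an equivariant map. -/
def complIncl {X D : FinGSet G} (i : X →[G] D) : FinGSet.compl i →[G] D where
  toFun d := d.1
  map_smul' _ _ := rfl

/-- Makes induction on cardinality possible when orbits are split off one at a time. -/
theorem card_compl_lt {X D : FinGSet G} (i : X →[G] D) (x : X) :
    Nat.card (FinGSet.compl i) < Nat.card D :=
  Finite.card_subtype_lt (x := i x) (not_not.2 ⟨x, rfl⟩)

theorem copair_complIncl_bijective {X D : FinGSet G} (i : X →[G] D)
    (hi : Function.Injective i) : Function.Bijective (copair i (complIncl i)) := by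
  refine ⟨?_, fun d => ?_⟩
  · rintro (x | x) (y | y) h
    · exact congrArg Sum.inl (hi h)
    · exact (y.2 ⟨x, h⟩).elim
    · exact (x.2 ⟨y, h.symm⟩).elim
    · exact congrArg Sum.inr (Subtype.ext h)
  · by_cases hd : d ∈ Set.range i
    · obtain ⟨x, rfl⟩ := hd
      exact ⟨Sum.inl x, rfl⟩
    · exact ⟨Sum.inr ⟨d, hd⟩, rfl⟩

/-- The norm map of a composite of bispans whose norm maps are surjective is surjective. -/
theorem Bispan.comp_n_surjective {X Y Z : FinGSet G} {β : Bispan X Y} {γ : Bispan Y Z}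
    (hβ : Function.Surjective β.n) (hγ : Function.Surjective γ.n) :
    Function.Surjective (β.comp γ).n := by
  intro p
  obtain ⟨c, hc⟩ := hγ (CompB.d p)
  obtain ⟨a, ha⟩ := hβ (CompB.s p c hc)
  exact ⟨⟨p, c, hc, a, ha⟩, rfl⟩

/-- The sections of `p ⨿ id : C ⨿ Y → Y ⨿ Y` over the fibres of `∇ : Y ⨿ Y → Y`. -/
theorem polyT_N_fold_id {C Y : FinGSet G} (p : C →[G] Y) :
    (polyT (sumMap p (MulActionHom.id G)) ≫ polyN (fold Y) : PolyHom (C.sum Y) Y) =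
    ((polyR (sumMap (MulActionHom.id G) p) ≫ polyN (fold C) : PolyHom (C.sum Y) C) ≫
      polyT p : PolyHom (C.sum Y) Y) := by
  refine Eq.trans ?_ (polyR_N_T (⟨_, _, sumMap (MulActionHom.id G) p, fold C, p⟩ :
    Bispan (C.sum Y) Y)).symm
  symm
  let β : Bispan (C.sum Y) (Y.sum Y) :=
    ⟨_, _, MulActionHom.id G, MulActionHom.id G, sumMap p (MulActionHom.id G)⟩
  let γ : Bispan (Y.sum Y) Y := ⟨_, _, MulActionHom.id G, fold Y, MulActionHom.id G⟩
  -- A section over the fibre of ∇ at y is free only on the left copy of y, where it picks a point c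
  -- with p c = y; on the right copy it is forced. So the dependent product is C.
  let s : C → Y.sum Y → C.sum Y := fun c => Sum.elim (fun _ => Sum.inl c) Sum.inr
  let b : C → CompB β γ := fun c => ⟨p c, fun y _ => s c y, by
    rintro (y | y) hy
    · exact congrArg Sum.inl (show p c = y from Eq.symm hy)
    · rfl⟩
  have hb : ∀ (g : G) (c : C), b (g • c) = g • b c := fun g c =>
    CompB.ext' (map_smul p g c) (by
      rintro (y | y) _ _
      · rfl
      · exact congrArg Sum.inr (smul_inv_smul g y).symm)
  have hbi : Function.Injective b := fun c c' h => by
    -- The point c is recovered by evaluating the section on the left copy.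
    have h1 : s c (inl Y Y (p c)) = s c' (inl Y Y (p c')) :=
      CompB.s_congr h (congrArg (inl Y Y) (congrArg CompB.d h)) rfl rfl
    exact Sum.inl_injective h1
  have hbs : Function.Surjective b := fun z => by
    obtain ⟨d, t, ht⟩ := z
    have h1 := ht (inl Y Y d) rfl
    have h2 := ht (inr Y Y d) rfl
    rcases hl : t (inl Y Y d) rfl with c | c
    · rw [hl] at h1
      obtain rfl : p c = d := Sum.inl_injective h1
      rcases hr : t (inr Y Y (p c)) rfl with y | y
      · rw [hr] at h2
        exact (Sum.inl_ne_inr h2).elim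
      · rw [hr] at h2
        obtain rfl : y = p c := Sum.inr_injective h2
        refine ⟨c, CompB.ext' rfl ?_⟩
        rintro (y | y) hy hy'
        · obtain rfl : y = p c := hy
          exact hl.symm
        · obtain rfl : y = p c := hy
          exact hr.symm
    · rw [hl] at h1
      exact (Sum.inr_ne_inl h1).elim
  refine Bispan.cls_eq (BispanIso.ofBijective (γ := β.comp γ)
    { toFun := fun x => (⟨b (fold C x), sumMap p p x, by rcases x with x | x <;> rfl,
        sumMap (MulActionHom.id G) p x, by rcases x with x | x <;> rfl⟩ : CompA β γ)
      map_smul' := fun g x => CompA.ext' ((congrArg b (map_smul (fold C) g x)).trans (hb g _))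
        (map_smul (sumMap p p) g x) (map_smul (sumMap (MulActionHom.id G) p) g x) }
    { toFun := b
      map_smul' := hb } ⟨?_, fun z => ?_⟩ ⟨hbi, hbs⟩ ?_ ?_ ?_)
  · rintro (x | x) (y | y) h
    · exact congrArg Sum.inl (hbi (congrArg CompA.p h))
    · exact (Sum.inl_ne_inr (congrArg CompA.c h)).elim
    · exact (Sum.inr_ne_inl (congrArg CompA.c h)).elim
    · exact congrArg Sum.inr (hbi (congrArg CompA.p h))
  · obtain ⟨z, y, hy, x, hx⟩ := z
    obtain ⟨c, rfl⟩ := hbs z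
    rcases y with y | y
    · obtain rfl : y = p c := hy
      exact ⟨Sum.inl c, CompA.ext' rfl rfl hx.symm⟩
    · obtain rfl : y = p c := hy
      exact ⟨Sum.inr c, CompA.ext' rfl rfl hx.symm⟩
  · exact fun _ => rfl
  · exact fun _ => rfl
  · exact fun _ => rfl

end GSets

end Tambara

/-! ### Multiplicativity, the projection formula and decomposition over disjoint unions. -/

namespace Tambara

namespace SemiTambaraFunctor

variable {G : Type u} [Group G] (S : SemiTambaraFunctor.{u, v} G) {X Y Z : FinGSet G}

theorem map_cls (β : Bispan X Y) (x : S.obj X) :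
    S.map β.cls x = S.tr β.t (S.nm β.n (S.res β.r x)) := by
  rw [← polyR_N_T, map_comp, map_comp]
  rfl

/-- Presents a multiplicative translate as the action of one bispan with identity transfer leg, so
that it can be composed with other bispans. -/
theorem nm_res_eq_map {D : FinGSet G} (v : D →[G] Y) (w : D →[G] X) (x : S.obj X) :
    S.nm v (S.res w x) = S.map (Bispan.cls ⟨D, Y, w, v, MulActionHom.id G⟩) x := by
  rw [map_cls]
  exact (S.map_id _).symm

theorem res_sumMap_pair {X' Y' : FinGSet G} (f : X →[G] X') (g : Y →[G] Y') (a : S.obj X')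
    (b : S.obj Y') : S.res (sumMap f g) (S.pair a b) = S.pair (S.res f a) (S.res g b) := by
  refine S.eq_pair ?_ ?_
  · rw [← res_comp]
    change S.res ((inl _ _).comp f) _ = _
    rw [res_comp, res_inl_pair]
  · rw [← res_comp]
    change S.res ((inr _ _).comp g) _ = _
    rw [res_comp, res_inr_pair]

/-- Base change for norms: the square formed by f, f ⨿ f and the two fold maps is cartesian. -/
theorem res_mul (f : X →[G] Y) (a b : S.obj Y) : S.res f (a * b) = S.res f a * S.res f b := by
  rw [mul_def, mul_def, ← res_sumMap_pair]
  refine S.isCovariant_nm.base _ _ _ _ ⟨?_, ?_, ?_⟩ _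
  · rintro (x | x) <;> rfl
  · rintro (x | x) (y | y) h h'
    · exact congrArg Sum.inl h'
    · exact (Sum.inl_ne_inr h).elim
    · exact (Sum.inr_ne_inl h).elim
    · exact congrArg Sum.inr h'
  · rintro (y | y) x (rfl : y = f x)
    · exact ⟨Sum.inl x, rfl, rfl⟩
    · exact ⟨Sum.inr x, rfl, rfl⟩

/-- Functoriality of norms applied to f ∘ ∇ = ∇ ∘ (f ⨿ f). -/
theorem nm_mul (f : X →[G] Y) (a b : S.obj X) : S.nm f (a * b) = S.nm f a * S.nm f b := by
  rw [mul_def, mul_def, ← S.isCovariant_nm.sumMap_pair, ← S.isCovariant_nm.comp,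
    ← S.isCovariant_nm.comp]
  congr 1
  ext x
  obtain x | x := x <;> rfl

/-- The projection formula. -/
theorem tr_mul (p : X →[G] Y) (e : S.obj X) (z : S.obj Y) :
    S.tr p e * z = S.tr p (e * S.res p z) := by
  have h : S.pair (S.tr p e) z = S.tr (sumMap p (MulActionHom.id G)) (S.pair e z) := by
    rw [S.isCovariant_tr.sumMap_pair, S.isCovariant_tr.id]
  -- The left side is a transfer along p ⨿ id followed by the norm along ∇; `polyT_N_fold_id`
  -- exchanges the two.
  rw [mul_def, h, nm, tr, tr, ← map_comp, polyT_N_fold_id, map_comp, map_comp]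
  change S.tr p (S.nm _ (S.res _ _)) = _
  rw [res_sumMap_pair, res_id]
  rfl

namespace IsCovariant

variable {S} {op : ∀ ⦃X Y : FinGSet G⦄, (X →[G] Y) → S.obj X → S.obj Y}

/-- Transfers and norms over a disjoint union. -/
theorem fold_pair_compl (hop : S.IsCovariant op) {D : FinGSet G} (i : X →[G] D)
    (hi : Function.Injective i) (f : D →[G] Y) (e : S.obj D) :
    op f e = op (fold Y) (S.pair (op (f.comp i) (S.res i e))
      (op (f.comp (complIncl i)) (S.res (complIncl i) e))) := by
  have hψ := copair_complIncl_bijective i hi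
  let ψ := copair i (complIncl i)
  let ψ' : D →[G] X.sum (FinGSet.compl i) :=
    { toFun := (Equiv.ofBijective _ hψ).symm
      map_smul' := fun g d => by
        rw [Equiv.symm_apply_eq]
        change g • d = ψ (g • (Equiv.ofBijective _ hψ).symm d)
        rw [map_smul]
        exact congrArg (g • ·) ((Equiv.ofBijective _ hψ).apply_symm_apply d).symm }
  -- Along an isomorphism, `op` is restriction along the inverse, so it undoes restriction.
  have h1 : op ψ (S.res ψ e) = e := by
    rw [hop.of_inverse ψ ψ' (Equiv.ofBijective _ hψ).symm_apply_apply
      (Equiv.ofBijective _ hψ).apply_symm_apply, ← S.res_comp]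
    have : ψ.comp ψ' = MulActionHom.id G := by
      ext d
      exact (Equiv.ofBijective _ hψ).apply_symm_apply d
    rw [this, S.res_id]
  have h2 : S.res ψ e = S.pair (S.res i e) (S.res (complIncl i) e) := by
    refine S.eq_pair ?_ ?_
    · rw [← res_comp]
      rfl
    · rw [← res_comp]
      rfl
  rw [← hop.sumMap_pair, ← hop.comp, ← h2]
  conv_lhs => rw [← h1, ← hop.comp]
  congr 1
  ext x
  obtain x | x := x <;> rfl

end IsCovariant

/-- The norm over a disjoint union is the product of the norms. -/
theorem nm_eq_mul {D : FinGSet G} (i : X →[G] D) (hi : Function.Injective i) (f : D →[G] Y)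
    (e : S.obj D) : S.nm f e = S.nm (f.comp i) (S.res i e) *
      S.nm (f.comp (complIncl i)) (S.res (complIncl i) e) :=
  S.isCovariant_nm.fold_pair_compl i hi f e

/-- The transfer over a disjoint union is the sum of the transfers. -/
theorem tr_eq_add {D : FinGSet G} (i : X →[G] D) (hi : Function.Injective i) (f : D →[G] Y)
    (e : S.obj D) : S.tr f e = S.tr (f.comp i) (S.res i e) +
      S.tr (f.comp (complIncl i)) (S.res (complIncl i) e) :=
  S.isCovariant_tr.fold_pair_compl i hi f e

/-- The map factors through ∅, whose value is a point, and 0 is by definition the transfer of that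
point. -/
theorem tr_of_isEmpty {D : FinGSet G} [IsEmpty D] (f : D →[G] Y) (e : S.obj D) :
    S.tr f e = 0 := by
  let j : D →[G] FinGSet.empty G := ⟨fun x => isEmptyElim x, fun _ x => isEmptyElim x⟩
  have h : f = (bang Y).comp j := by
    ext x
    exact isEmptyElim x
  rw [h, S.isCovariant_tr.comp, Subsingleton.elim (S.tr j e) default]
  rfl

end SemiTambaraFunctor

end Tambara

/-! ### Maps between orbits. -/

namespace Tambara

section Orbits

variable {G : Type u} [Group G] [Finite G]

/-- The inclusion of the orbit of a point. -/
def orbitIncl {D : FinGSet G} (d : D) : FinGSet.orbit (MulAction.stabilizer G d) →[G] D where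
  toFun := MulAction.ofQuotientStabilizer G d
  map_smul' := MulAction.ofQuotientStabilizer_smul G d

theorem orbitIncl_injective {D : FinGSet G} (d : D) : Function.Injective (orbitIncl d) :=
  MulAction.injective_ofQuotientStabilizer G d

instance FinGSet.nonempty_orbit (H : Subgroup G) : Nonempty (FinGSet.orbit H) :=
  ⟨(QuotientGroup.mk 1 : G ⧸ H)⟩

instance FinGSet.isPretransitive_orbit (H : Subgroup G) :
    MulAction.IsPretransitive G (FinGSet.orbit H) :=
  inferInstanceAs (MulAction.IsPretransitive G (G ⧸ H))

/-- The target is transitive. This supplies the surjectivity of norm legs ending in an orbit. -/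
theorem surjective_of_nonempty {D : FinGSet G} [Nonempty D] {K : Subgroup G}
    (v : D →[G] FinGSet.orbit K) : Function.Surjective v := fun y => by
  obtain ⟨d⟩ := ‹Nonempty D›
  obtain ⟨g, hg⟩ := MulAction.exists_smul_eq G (v d) y
  exact ⟨g • d, (map_smul v g d).trans hg⟩

/-- Every map of orbits is the composite of a conjugation and a projection. -/
theorem exists_eq_orbitProj_comp_orbitConj {H K : Subgroup G}
    (u : FinGSet.orbit H →[G] FinGSet.orbit K) :
    ∃ (g : G) (h : conjSubgroup g H ≤ K), u = (orbitProj h).comp (orbitConj g H) := by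
  obtain ⟨g, hg⟩ : ∃ g : G, (QuotientGroup.mk g : G ⧸ K) = u (QuotientGroup.mk 1 : G ⧸ H) :=
    QuotientGroup.mk_surjective _
  have key : ∀ x : G, u (QuotientGroup.mk x : G ⧸ H) = (QuotientGroup.mk (x * g) : G ⧸ K) := by
    intro x
    have h1 : (QuotientGroup.mk x : G ⧸ H) = x • (QuotientGroup.mk 1 : G ⧸ H) :=
      congrArg QuotientGroup.mk (mul_one x).symm
    rw [h1]
    refine (map_smul u x _).trans ?_
    rw [← hg]
    rfl
  -- By `key`, u is right multiplication by g, while `orbitConj` multiplies by the inverse of its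
  -- argument.
  refine ⟨g⁻¹, ?_, ?_⟩
  · rintro _ ⟨m, hm, rfl⟩
    have h1 : (QuotientGroup.mk 1 : G ⧸ H) = QuotientGroup.mk m :=
      QuotientGroup.eq.2 (by simpa using hm)
    have h2 := (key 1).symm.trans ((congrArg u h1).trans (key m))
    have h3 : (QuotientGroup.mk (1 * g) : G ⧸ K) = QuotientGroup.mk (m * g) := h2
    rw [QuotientGroup.eq] at h3
    simpa [mul_assoc] using h3
  · ext x
    refine Quotient.inductionOn' x fun x => ?_
    refine (key x).trans ?_
    change _ = (QuotientGroup.mk (x * g⁻¹⁻¹) : G ⧸ K)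
    rw [inv_inv]

/-- The inverse of a conjugation. -/
theorem exists_orbitConj_inverse (g : G) (H : Subgroup G) :
    ∃ e : FinGSet.orbit (conjSubgroup g H) →[G] FinGSet.orbit H,
      (∀ x, e (orbitConj g H x) = x) ∧ ∀ y, orbitConj g H (e y) = y := by
  have hs : Function.Surjective (orbitConj g H) := surjective_of_nonempty _
  have hi : Function.Injective (orbitConj g H) := by
    intro x y
    refine Quotient.inductionOn₂' x y fun x y h => ?_
    have h1 : (QuotientGroup.mk (x * g⁻¹) : G ⧸ conjSubgroup g H) = QuotientGroup.mk (y * g⁻¹) := h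
    rw [QuotientGroup.eq] at h1
    obtain ⟨z, hz, hzz⟩ := h1
    refine QuotientGroup.eq.2 ?_
    have : z = x⁻¹ * y := by
      have h2 : g * z * g⁻¹ = (x * g⁻¹)⁻¹ * (y * g⁻¹) := hzz
      have h3 : z = g⁻¹ * (g * z * g⁻¹) * g := by group
      rw [h3, h2]
      group
    rwa [← this]
  let E := Equiv.ofBijective _ ⟨hi, hs⟩
  refine ⟨⟨E.symm, fun m y => ?_⟩, E.symm_apply_apply, E.apply_symm_apply⟩
  rw [Equiv.symm_apply_eq]
  exact ((map_smul (orbitConj g H) m (E.symm y)).trans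
    (congrArg (m • ·) (E.apply_symm_apply y))).symm

/-- A map from an orbit to a disjoint union has its image in one of the two parts. -/
theorem exists_eq_inl_comp_or_inr_comp {X Y : FinGSet G} {L : Subgroup G}
    (w : FinGSet.orbit L →[G] X.sum Y) :
    (∃ w', w = (inl X Y).comp w') ∨ ∃ w', w = (inr X Y).comp w' := by
  obtain ⟨d⟩ := FinGSet.nonempty_orbit L
  rcases hd : w d with x | y
  · have h : ∀ e, ∃ x', w e = inl X Y x' := fun e => by
      obtain ⟨g, rfl⟩ := MulAction.exists_smul_eq G d e
      refine ⟨g • x, (map_smul w g d).trans ?_⟩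
      rw [hd]
      rfl
    choose w' hw' using h
    refine Or.inl ⟨⟨w', fun g e => ?_⟩, MulActionHom.ext hw'⟩
    refine Sum.inl_injective (β := Y) ?_
    exact (hw' _).symm.trans ((map_smul w g e).trans (congrArg (g • ·) (hw' e)))
  · have h : ∀ e, ∃ x', w e = inr X Y x' := fun e => by
      obtain ⟨g, rfl⟩ := MulAction.exists_smul_eq G d e
      refine ⟨g • y, (map_smul w g d).trans ?_⟩
      rw [hd]
      rfl
    choose w' hw' using h
    refine Or.inr ⟨⟨w', fun g e => ?_⟩, MulActionHom.ext hw'⟩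
    refine Sum.inr_injective (α := X) ?_
    exact (hw' _).symm.trans ((map_smul w g e).trans (congrArg (g • ·) (hw' e)))

end Orbits

/-! ### Ideals under arbitrary maps of orbits. -/

namespace TambaraIdeal

variable {G : Type u} [Group G] [Finite G] {T : TambaraFunctor.{u, v} G} (P : TambaraIdeal T)

theorem tr_orbit_mem {H K : Subgroup G} (u : FinGSet.orbit H →[G] FinGSet.orbit K) {x : T.level H}
    (hx : x ∈ P.ideal H) : T.tr u x ∈ P.ideal K := by
  obtain ⟨g, h, rfl⟩ := exists_eq_orbitProj_comp_orbitConj u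
  rw [T.isCovariant_tr.comp]
  exact P.tr_mem _ _ _ _ (P.conj_mem _ _ _ hx)

/-- The ideal axioms treat conjugation as a transfer; on an isomorphism, norm and transfer agree,
both being restriction along the inverse. -/
theorem nm_orbit_mem {H K : Subgroup G} (u : FinGSet.orbit H →[G] FinGSet.orbit K) {x : T.level H}
    (hx : x ∈ P.ideal H) : T.nm u x ∈ P.ideal K := by
  obtain ⟨g, h, rfl⟩ := exists_eq_orbitProj_comp_orbitConj u
  obtain ⟨e, he, he'⟩ := exists_orbitConj_inverse g H
  rw [T.isCovariant_nm.comp, T.isCovariant_nm.of_inverse _ e he he',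
    ← T.isCovariant_tr.of_inverse _ e he he']
  exact P.nm_mem _ _ _ _ (P.conj_mem _ _ _ hx)

/-- Restriction along a conjugation is transfer along its inverse, which is again a map of orbits.
-/
theorem res_orbit_mem {H K : Subgroup G} (u : FinGSet.orbit H →[G] FinGSet.orbit K) {x : T.level K}
    (hx : x ∈ P.ideal K) : T.res u x ∈ P.ideal H := by
  obtain ⟨g, h, rfl⟩ := exists_eq_orbitProj_comp_orbitConj u
  obtain ⟨e, he, he'⟩ := exists_orbitConj_inverse g H
  rw [T.res_comp, ← T.isCovariant_tr.of_inverse e _ he' he]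
  exact P.tr_orbit_mem e (P.res_mem _ _ _ _ hx)

/-- An element of `T(C)` whose restrictions to all orbits belong to `P` has its transfers in `P`. -/
theorem tr_mem_of_forall_res_mem {K : Subgroup G} {C : FinGSet G} (p : C →[G] FinGSet.orbit K)
    (e : T.obj C) (he : ∀ (M : Subgroup G) (φ : FinGSet.orbit M →[G] C), T.res φ e ∈ P.ideal M) :
    T.tr p e ∈ P.ideal K := by
  -- Split off the orbit of a point: the transfer is the sum of an orbit transfer and the transfer
  -- from a smaller G-set.
  induction hn : Nat.card C using Nat.strong_induction_on generalizing C with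
  | _ n ih =>
    rcases isEmpty_or_nonempty C with hC | ⟨⟨c⟩⟩
    · rw [T.tr_of_isEmpty]
      exact zero_mem _
    · rw [T.tr_eq_add (orbitIncl c) (orbitIncl_injective c)]
      refine add_mem (P.tr_orbit_mem _ (he _ _)) (ih _ ?_ _ _ (fun M φ => ?_) rfl)
      · rw [← hn]
        exact card_compl_lt (orbitIncl c) (QuotientGroup.mk 1 : G ⧸ MulAction.stabilizer G c)
      · rw [← T.res_comp]
        exact he _ _

/-! ### Colon ideals and Nakaoka's criterion. -/

section Colon

variable (N : ∀ K : Subgroup G, Set (T.level K))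

/-- The elements of `T(X)` all of whose multiplicative translates multiply `N` into `P`. -/
def TranslatesMulMem {X : FinGSet G} (x : T.obj X) : Prop :=
  ∀ (K L : Subgroup G) (v : FinGSet.orbit L →[G] FinGSet.orbit K) (w : FinGSet.orbit L →[G] X),
    ∀ z ∈ N K, T.nm v (T.res w x) * z ∈ P.ideal K

namespace TranslatesMulMem

variable {P N} {X Y : FinGSet G}

/-- The orbit of any point of D contributes a factor to which the hypothesis applies. Nonemptiness
is essential: the norm over ∅ is 1. -/
theorem nm_mul_mem {x : T.obj X} (hx : P.TranslatesMulMem N x) {D : FinGSet G} [Nonempty D]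
    {K : Subgroup G} (v : D →[G] FinGSet.orbit K) (w : D →[G] X) {z : T.level K} (hz : z ∈ N K) :
    T.nm v (T.res w x) * z ∈ P.ideal K := by
  obtain ⟨d⟩ := ‹Nonempty D›
  rw [T.nm_eq_mul (orbitIncl d) (orbitIncl_injective d), ← T.res_comp, mul_right_comm]
  exact Ideal.mul_mem_right _ _ (hx _ _ _ _ z hz)

/-- The projection formula puts z under the transfer, where membership is tested on orbits. There,
base change gives a norm over a pullback times a restriction of z. Surjectivity of the norm leg
keeps that pullback nonempty. -/
theorem map_mul_mem (hN : ∀ (M K : Subgroup G) (u : FinGSet.orbit M →[G] FinGSet.orbit K),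
      ∀ z ∈ N K, T.res u z ∈ N M) {x : T.obj X} (hx : P.TranslatesMulMem N x) {K : Subgroup G}
    (β : Bispan X (FinGSet.orbit K)) (hβ : Function.Surjective β.n) {z : T.level K}
    (hz : z ∈ N K) : T.map β.cls x * z ∈ P.ideal K := by
  rw [T.map_cls, T.tr_mul]
  refine P.tr_mem_of_forall_res_mem _ _ fun M φ => ?_
  rw [T.res_mul, T.isCovariant_nm.base _ _ _ _ (isCartesian_pullback β.n φ), ← T.res_comp,
    ← T.res_comp]
  have : Nonempty (FinGSet.pullback β.n φ) := by
    obtain ⟨m⟩ := FinGSet.nonempty_orbit M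
    obtain ⟨a, ha⟩ := hβ (φ m)
    exact ⟨⟨(a, m), ha⟩⟩
  exact hx.nm_mul_mem _ _ (hN _ _ _ z hz)

/-- A multiplicative translate of the image of x is the image of x under a composite bispan, whose
norm leg is still surjective. Closure of `colon` under sums, restrictions, transfers, norms and
conjugations is a special case. -/
theorem map (hN : ∀ (M K : Subgroup G) (u : FinGSet.orbit M →[G] FinGSet.orbit K),
      ∀ z ∈ N K, T.res u z ∈ N M) {x : T.obj X} (hx : P.TranslatesMulMem N x)
    (β : Bispan X Y) (hβ : Function.Surjective β.n) :
    P.TranslatesMulMem N (T.map β.cls x) := fun K L v w z hz => by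
  rw [T.nm_res_eq_map, ← T.map_comp]
  exact hx.map_mul_mem hN (β.comp ⟨_, _, w, v, MulActionHom.id G⟩)
    (Bispan.comp_n_surjective hβ (surjective_of_nonempty v)) hz

/-- An orbit maps into a single summand, so only one component is seen at a time. -/
theorem pair {x : T.obj X} {y : T.obj Y} (hx : P.TranslatesMulMem N x)
    (hy : P.TranslatesMulMem N y) : P.TranslatesMulMem N (T.pair x y) := fun K L v w z hz => by
  obtain ⟨w, rfl⟩ | ⟨w, rfl⟩ := exists_eq_inl_comp_or_inr_comp w
  · rw [T.res_comp, T.res_inl_pair]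
    exact hx K L v w z hz
  · rw [T.res_comp, T.res_inr_pair]
    exact hy K L v w z hz

theorem mul_left {x : T.obj X} (hx : P.TranslatesMulMem N x) (c : T.obj X) :
    P.TranslatesMulMem N (c * x) := fun K L v w z hz => by
  rw [T.res_mul, T.nm_mul, mul_assoc]
  exact Ideal.mul_mem_left _ _ (hx K L v w z hz)

end TranslatesMulMem

/-- The ideal of all elements whose multiplicative translates multiply `N` into `P`. -/
def colon (hN : ∀ (M K : Subgroup G) (u : FinGSet.orbit M →[G] FinGSet.orbit K),
    ∀ z ∈ N K, T.res u z ∈ N M) : TambaraIdeal T where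
  ideal H :=
    { carrier := {x | P.TranslatesMulMem N x}
      -- A sum is the image of a pair under the bispan T_∇.
      add_mem' := fun hx hy => (TranslatesMulMem.pair hx hy).map hN
        ⟨_, _, MulActionHom.id G, MulActionHom.id G, fold _⟩ Function.surjective_id
      -- Zero is transferred from ∅, where the condition is vacuous because no orbit maps to ∅.
      zero_mem' := TranslatesMulMem.map hN (x := (default : T.obj (FinGSet.empty G)))
        (fun K L v w => by
          obtain ⟨d⟩ := FinGSet.nonempty_orbit L
          exact isEmptyElim (w d))
        ⟨_, _, MulActionHom.id G, MulActionHom.id G, bang _⟩ Function.surjective_id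
      smul_mem' := fun c x hx => hx.mul_left c }
  res_mem _ _ h _ hx := TranslatesMulMem.map hN hx
    ⟨_, _, orbitProj h, MulActionHom.id G, MulActionHom.id G⟩ Function.surjective_id
  tr_mem _ _ h _ hx := TranslatesMulMem.map hN hx
    ⟨_, _, MulActionHom.id G, MulActionHom.id G, orbitProj h⟩ Function.surjective_id
  nm_mem _ _ h _ hx := TranslatesMulMem.map hN hx
    ⟨_, _, MulActionHom.id G, orbitProj h, MulActionHom.id G⟩ (surjective_of_nonempty _)
  conj_mem g H _ hx := TranslatesMulMem.map hN hx
    ⟨_, _, MulActionHom.id G, MulActionHom.id G, orbitConj g H⟩ Function.surjective_id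

variable {N}

theorem mul_mem_of_mem_colon {hN : ∀ (M K : Subgroup G) (u : FinGSet.orbit M →[G] FinGSet.orbit K),
    ∀ z ∈ N K, T.res u z ∈ N M} {K : Subgroup G} {x z : T.level K}
    (hx : x ∈ (P.colon N hN).ideal K) (hz : z ∈ N K) : x * z ∈ P.ideal K := by
  have h := hx K K (MulActionHom.id G) (MulActionHom.id G) z hz
  rwa [T.res_id, T.isCovariant_nm.id] at h

end Colon

variable {P}

/-- Nakaoka's criterion: if the products of all multiplicative translates of `a` and `b` belong to
a prime ideal, then so does `a` or `b`. -/
theorem IsPrime.mem_or_mem (hP : P.IsPrime) {H K : Subgroup G} {a : T.level H} {b : T.level K}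
    (h : ∀ (M L L' : Subgroup G) (v : FinGSet.orbit L →[G] FinGSet.orbit M)
      (w : FinGSet.orbit L →[G] FinGSet.orbit H) (v' : FinGSet.orbit L' →[G] FinGSet.orbit M)
      (w' : FinGSet.orbit L' →[G] FinGSet.orbit K),
      T.nm v (T.res w a) * T.nm v' (T.res w' b) ∈ P.ideal M) :
    a ∈ P.ideal H ∨ b ∈ P.ideal K := by
  -- Translates of a over all nonempty D, not only orbits: restricting an orbit translate gives a
  -- norm over a pullback, which need not be an orbit.
  let N : ∀ M : Subgroup G, Set (T.level M) := fun M =>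
    {z | ∃ (D : FinGSet G) (_ : Nonempty D) (v : D →[G] FinGSet.orbit M)
      (w : D →[G] FinGSet.orbit H), z = T.nm v (T.res w a)}
  have hN : ∀ (M K : Subgroup G) (u : FinGSet.orbit M →[G] FinGSet.orbit K),
      ∀ z ∈ N K, T.res u z ∈ N M := by
    rintro M K u _ ⟨D, _, v, w, rfl⟩
    obtain ⟨m⟩ := FinGSet.nonempty_orbit M
    obtain ⟨d, hd⟩ := surjective_of_nonempty v (u m)
    refine ⟨FinGSet.pullback v u, ⟨⟨(d, m), hd⟩⟩, pullbackSnd v u, w.comp (pullbackFst v u), ?_⟩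
    rw [T.isCovariant_nm.base _ _ _ _ (isCartesian_pullback v u), T.res_comp]
  -- B multiplies the translates of a into P, and A multiplies B into P. Hence AB ≤ P, and a lies in
  -- A because its translates belong to N.
  let B := P.colon N hN
  let A := P.colon (fun M => B.ideal M) fun M K u z hz => B.res_orbit_mem u hz
  have ha : a ∈ A.ideal H := by
    intro M L v w z hz
    rw [mul_comm]
    exact P.mul_mem_of_mem_colon hz ⟨_, FinGSet.nonempty_orbit L, v, w, rfl⟩
  have hb : b ∈ B.ideal K := by
    rintro M L' v' w' _ ⟨D, ⟨d⟩, v, w, rfl⟩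
    -- The hypothesis concerns orbits only; one orbit of D provides a factor that suffices.
    rw [T.nm_eq_mul (orbitIncl d) (orbitIncl_injective d), ← T.res_comp, ← mul_assoc,
      mul_comm (T.nm v' _)]
    exact Ideal.mul_mem_right _ _ (h _ _ _ _ _ _ _)
  have hAB : A * B ≤ P := fun M x hx => mem_sInf.1 hx P fun M =>
    Ideal.mul_le.2 fun x hx y hy => P.mul_mem_of_mem_colon hx hy
  exact (hP.le_or_le A B hAB).imp (fun h => h H ha) fun h => h K hb

end TambaraIdeal

/-! ### Ultrafilter limits of primes. -/

namespace Spec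

variable {G : Type u} [Group G] [Finite G] {T : TambaraFunctor.{u, v} G}

/-- The ideal of all elements which eventually belong to the prime ideals along a filter. -/
def eventualIdeal (l : Filter (Spec T)) : TambaraIdeal T where
  ideal H :=
    { carrier := {x | ∀ᶠ Q in l, x ∈ Q.asIdeal.ideal H}
      add_mem' := fun hx hy => by
        filter_upwards [hx, hy] with Q h h' using add_mem h h'
      zero_mem' := Filter.Eventually.of_forall fun Q => zero_mem _
      smul_mem' := fun c x hx => by
        filter_upwards [hx] with Q h using Submodule.smul_mem _ c h }
  res_mem H K h _ hx := by
    filter_upwards [hx] with Q hQ using Q.asIdeal.res_mem H K h _ hQ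
  tr_mem H K h _ hx := by
    filter_upwards [hx] with Q hQ using Q.asIdeal.tr_mem H K h _ hQ
  nm_mem H K h _ hx := by
    filter_upwards [hx] with Q hQ using Q.asIdeal.nm_mem H K h _ hQ
  conj_mem g H _ hx := by
    filter_upwards [hx] with Q hQ using Q.asIdeal.conj_mem g H _ hQ

theorem mem_eventualIdeal {l : Filter (Spec T)} {H : Subgroup G} {x : T.level H} :
    x ∈ (eventualIdeal l).ideal H ↔ ∀ᶠ Q in l, x ∈ Q.asIdeal.ideal H := Iff.rfl

/-- Makes the family of conditions in `IsPrime.mem_or_mem` finite, so that it commutes with `∀ᶠ`. -/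
instance finite_hom (X Y : FinGSet G) : Finite (X →[G] Y) :=
  DFunLike.finite _

theorem isPrime_eventualIdeal (U : Ultrafilter (Spec T)) :
    (eventualIdeal (U : Filter (Spec T))).IsPrime where
  ne_top h := by
    have h1 : ∀ H (x : T.level H), ∀ᶠ Q in (U : Filter (Spec T)), x ∈ Q.asIdeal.ideal H := by
      intro H x
      rw [← mem_eventualIdeal, h]
      exact Submodule.mem_top
    -- As there are finitely many subgroups, a single Q would contain 1 at every level.
    obtain ⟨Q, hQ⟩ := (Filter.eventually_all.2 fun H => h1 H 1).exists
    exact Q.isPrime.ne_top (TambaraIdeal.ext (funext fun H => (Ideal.eq_top_iff_one _).2 (hQ H)))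
  le_or_le I J hIJ := by
    by_contra! hc
    -- For an ultrafilter, not being eventually in Q means being eventually outside Q.
    have hex : ∀ I' : TambaraIdeal T, ¬ I' ≤ eventualIdeal U →
        ∃ H, ∃ a ∈ I'.ideal H, ∀ᶠ Q in (U : Filter (Spec T)), a ∉ Q.asIdeal.ideal H := by
      intro I' hI'
      by_contra! hn
      exact hI' hn
    obtain ⟨H, a, haI, ha⟩ := hex I hc.1
    obtain ⟨K, b, hbJ, hb⟩ := hex J hc.2
    have hab : ∀ᶠ Q in (U : Filter (Spec T)), ∀ (M L L' : Subgroup G)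
        (v : FinGSet.orbit L →[G] FinGSet.orbit M) (w : FinGSet.orbit L →[G] FinGSet.orbit H)
        (v' : FinGSet.orbit L' →[G] FinGSet.orbit M) (w' : FinGSet.orbit L' →[G] FinGSet.orbit K),
        T.nm v (T.res w a) * T.nm v' (T.res w' b) ∈ Q.asIdeal.ideal M := by
      simp only [Filter.eventually_all]
      intro M L L' v w v' w'
      -- Translates of a stay in I and those of b in J, so each product lies in IJ and hence in the
      -- limit ideal.
      refine mem_eventualIdeal.1 (hIJ M (TambaraIdeal.mem_sInf.2 fun R hR => hR M ?_))
      exact Ideal.mul_mem_mul (I.nm_orbit_mem v (I.res_orbit_mem w haI))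
        (J.nm_orbit_mem v' (J.res_orbit_mem w' hbJ))
    obtain ⟨Q, haQ, hbQ, hQ⟩ := (ha.and (hb.and hab)).exists
    exact (Q.isPrime.mem_or_mem hQ).elim haQ hbQ

/-- Every ultrafilter converges to its ideal of eventual elements. -/
theorem le_nhds_eventualIdeal (U : Ultrafilter (Spec T)) :
    (U : Filter (Spec T)) ≤ nhds ⟨eventualIdeal U, isPrime_eventualIdeal U⟩ := by
  rw [le_nhds_iff]
  intro s hs hso
  obtain ⟨I, hI⟩ : sᶜ ∈ Set.range (zeroLocus (T := T)) := hso
  -- The limit lies in s, so it is not in V(I), the complement of s. Were V(I) in the ultrafilter,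
  -- every element of I would eventually lie in Q, giving I ≤ the limit.
  have hle : ¬ I ≤ eventualIdeal (U : Filter (Spec T)) := fun h => by
    have : (⟨eventualIdeal U, isPrime_eventualIdeal U⟩ : Spec T) ∈ sᶜ := hI ▸ h
    exact this hs
  rw [← compl_compl s, ← hI, Ultrafilter.mem_coe, Ultrafilter.compl_mem_iff_notMem]
  exact fun h => hle fun H x hx => Filter.mem_of_superset h fun Q hQ => hQ H hx

end Spec

end Tambara

theorem mainTheorem6 {G : Type u} [Group G] [Finite G] (T : Tambara.TambaraFunctor.{u, v} G)
    {H : Subgroup G} (f : T.level H) :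
    IsCompact (Tambara.Spec.basicOpen f : Set (Tambara.Spec T)) := by
  rw [isCompact_iff_ultrafilter_le_nhds]
  intro U hU
  refine ⟨⟨_, Tambara.Spec.isPrime_eventualIdeal U⟩, fun hf => ?_,
    Tambara.Spec.le_nhds_eventualIdeal U⟩
  have h : ∀ᶠ Q in (U : Filter (Tambara.Spec T)), f ∉ Q.asIdeal.ideal H :=
    Filter.le_principal_iff.1 hU
  obtain ⟨Q, hQ, hQ'⟩ := (h.and (Tambara.Spec.mem_eventualIdeal.1 hf)).exists
  exact hQ hQ'
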